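/- **Setting.** There are $N\ge 2$ users with weights $\beta_i\ge 0$, $\sum_{i=1}^N\beta_i=1$, and local objectives $F_i:\mathbb R^d\to\mathbb R$, and $F=\sum_i\beta_iF_i$ is the global objective, with minimizer $\mathbf w^*$. Write $F^*=\min F$, $F_i^*=\min F_i$ and $\Gamma=F^*-\sum_i\beta_iF_i^*$. Let $E\ge 1$ be the number of local steps, let $J$ be a positive multiple of $E$, let $\theta\in[0,1)$, $0<\alpha\le N-1$, $c>0$, and put $$p=1-\Big(1-\tfrac{\alpha}{N-1}\Big)^{N-1},\qquad p'=(1-\theta)p,\qquad \tilde p=(1-\theta)^2\Big(1-2\big(1-\tfrac{\alpha}{N-1}\big)^{N-1}+\big(1-\tfrac{\alpha}{N-1}\big)^{2N-3}\Big).$$ *Randomness.* All of the following variables are mutually independent: the samples $\xi_i^{(t)}\sim\mathcal D_i$; the dropout indicators $D_i^{(t)}\in\{0,1\}$ with $P[D_i^{(t)}=0]=\theta$; for each unordered pair of users, time $t$ and location $\ell\in[d]$, a bit $b_{ij}^{(t)}(\ell)\in\{0,1\}$ that equals $1$ with probability $\alpha/(N-1)$; and the randomness of each quantization. User $i$ selects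 location $\ell$, $M_i^{(t)}(\ell)=1$, if $b_{ij}^{(t)}(\ell)=1$ for some $j\neq i$, and $M_i^{(t)}(\ell)=0$ otherwise. (So $P[M_i^{(t)}(\ell)=1]=p$, and $\tilde p=\mathbb E[D_i^{(t)}M_i^{(t)}(\ell)D_j^{(t)}M_j^{(t)}(\ell)]$ for $i\ne j$.) The stochastic quantizer is $Q(x)=(\lfloor cx\rfloor+1)/c$ with probability $cx-\lfloor cx\rfloor$ and $Q(x)=\lfloor cx\rfloor/c$ otherwise. *Scheme.* The stochastic gradients $\nabla F_i(\mathbf w,\xi)$ are unbiased: $\mathbb E_{\xi\sim\mathcal D_i}[\nabla F_i(\mathbf w,\xi)]=\nabla F_i(\mathbf w)$ for all $\mathbf w$. All users start from $\mathbf w_i^{(0)}=\mathbf w^{(0)}$. With $\mathbf z_i^{(t)}=\eta^{(t)}\nabla F_i(\mathbf w_i^{(t)},\xi_i^{(t)})$, the local models are $\mathbf w_i^{(t+1)}=\mathbf w_i^{(t)}-\mathbf z_i^{(t)}$ if $E\nmid t+1$, and, if $E\mid t+1$, with $t_o=t+1-E$ and for every $\ell\in[d]$, $$\mathbf w_i^{(t+1)}(\ell)=\mathbf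 w_i^{(t_o)}(\ell)-\sum_{j=1}^ND_j^{(t)}M_j^{(t)}(\ell)\,Q\Big(\frac{\beta_j}{p'}\sum_{k=t_o}^{t}\mathbf z_j^{(k)}(\ell)\Big).$$ Let $\overline{\mathbf w}^{(t)}=\sum_i\beta_i\mathbf w_i^{(t)}$. **Theorem.** Let $L,\mu>0$. Assume that every $F_i$ is differentiable, $L$-smooth, i.e. $F_i(\mathbf v)\le F_i(\mathbf w)+\langle\nabla F_i(\mathbf w),\mathbf v-\mathbf w\rangle+\frac L2\|\mathbf v-\mathbf w\|^2$ for all $\mathbf v,\mathbf w$, and $\mu$-strongly convex, and that for all $i$ and all $0\le t<J$ $$\mathbb E\|\nabla F_i(\mathbf w_i^{(t)},\xi_i^{(t)})-\nabla F_i(\mathbf w_i^{(t)})\|^2\le\sigma_i^2,\qquad \mathbb E\|\nabla F_i(\mathbf w_i^{(t)},\xi_i^{(t)})\|^2\le G^2 .$$ Let $\nu=\max\{8L/\mu,\,E\}$ and $\eta^{(t)}=\frac{2}{\mu(\nu+t)}$ (so that $\eta^{(t)}$ is decreasing and $\eta^{(t)}\le 2\eta^{(t+E)}$). Then $F(\overline{\mathbf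 w}^{(J)})$ is integrable and $$\mathbb E\big[F(\overline{\mathbf w}^{(J)})\big]-F^*\le\frac{2\frac L\mu}{\nu+J}\Big(\frac{B+C}{\mu}+2L\|\mathbf w^{(0)}-\mathbf w^*\|^2\Big),$$ where $$B=\sum_{i=1}^N\beta_i^2\sigma_i^2+6L\Gamma+8(E-1)^2G^2,$$ $$C=\frac{N d\,p'}{4c^2(\eta^{(J-1)})^2}+4E^2G^2\sum_{i=1}^N\Big(\beta_i^2\Big(\frac1{p'}-1\Big)+\sum_{j\ne i}\beta_i\beta_j\Big(\frac{\tilde p}{(p')^2}-1\Big)\Big).$$ -/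

import Mathlib

open MeasureTheory ProbabilityTheory

/-- Model parameters: `ℝ^d` with the Euclidean norm. -/
abbrev Model (d : ℕ) : Type := EuclideanSpace ℝ (Fin d)

/-- `f` is `L`-smooth: differentiable, with the quadratic upper bound of parameter `L`. -/
def LSmooth {d : ℕ} (L : ℝ) (f : Model d → ℝ) : Prop :=
  Differentiable ℝ f ∧
    ∀ v w : Model d, f v ≤ f w + inner ℝ (gradient f w) (v - w) + L / 2 * ‖v - w‖ ^ 2

/-- The data of the federated scheme with `N` users and samples in `Ξ`. -/
structure FedScheme (N d : ℕ) (Ξ : Type*) where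
  /-- aggregation weights -/
  β : Fin N → ℝ
  /-- dropout probability -/
  θ : ℝ
  /-- sparsification parameter: each pair of users selects a location with probability
  `α / (N - 1)` -/
  α : ℝ
  /-- quantization parameter: the quantization grid is `ℤ / c` -/
  c : ℝ
  /-- number of local steps between two synchronizations -/
  E : ℕ
  /-- learning rates -/
  η : ℕ → ℝ
  /-- stochastic gradients: `sg i w x` is `∇F_i(w, x)` -/
  sg : Fin N → Model d → Ξ → Model d
  /-- common initial model -/
  w₀ : Model d

/-- The sources of randomness of the scheme. -/
structure FedNoise (N d : ℕ) (Ξ Ω : Type*) where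
  /-- sample drawn by user `i` at time `t` -/
  sample : Fin N → ℕ → Ω → Ξ
  /-- whether user `i` drops out at time `t` -/
  dropped : Fin N → ℕ → Ω → Bool
  /-- selection bit that the unordered pair of users `e` shares at time `t` for a location -/
  bit : Sym2 (Fin N) → ℕ → Fin d → Ω → Bool
  /-- uniform variable that drives the stochastic rounding of user `i` at a location -/
  unif : Fin N → ℕ → Fin d → Ω → ℝ

/-- Labels of the individual random variables of a `FedNoise`. -/
inductive NoiseLabel (N d : ℕ) : Type
  | sample (i : Fin N) (t : ℕ) : NoiseLabel N d
  | dropped (i : Fin N) (t : ℕ) : NoiseLabel N d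
  | bit (e : Sym2 (Fin N)) (t : ℕ) (l : Fin d) : NoiseLabel N d
  | unif (i : Fin N) (t : ℕ) (l : Fin d) : NoiseLabel N d

/-- The σ-algebra on `Ω` generated by one of the random variables. -/
@[reducible] def FedNoise.sigma {N d : ℕ} {Ξ Ω : Type*} [MeasurableSpace Ξ] (Z : FedNoise N d Ξ Ω) :
    NoiseLabel N d → MeasurableSpace Ω
  | .sample i t => MeasurableSpace.comap (Z.sample i t) inferInstance
  | .dropped i t => MeasurableSpace.comap (Z.dropped i t) inferInstance
  | .bit e t l => MeasurableSpace.comap (Z.bit e t l) inferInstance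
  | .unif i t l => MeasurableSpace.comap (Z.unif i t l) inferInstance

/-- The joint law of the randomness: user `i` samples from `𝒟 i`, drops out with probability `θ`,
pairs of users select a location with probability `a`, the rounding variables are uniform on
`[0, 1]`, and all these variables are mutually independent. -/
structure FedNoise.HasJointLaw {N d : ℕ} {Ξ Ω : Type*} [MeasurableSpace Ξ] [MeasurableSpace Ω]
    (Z : FedNoise N d Ξ Ω) (P : Measure Ω) (𝒟 : Fin N → Measure Ξ) (θ a : ℝ) : Prop where
  measurable_sample : ∀ i t, Measurable (Z.sample i t)
  measurable_dropped : ∀ i t, Measurable (Z.dropped i t)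
  measurable_bit : ∀ e t l, Measurable (Z.bit e t l)
  measurable_unif : ∀ i t l, Measurable (Z.unif i t l)
  map_sample : ∀ i t, P.map (Z.sample i t) = 𝒟 i
  prob_dropped : ∀ i t, P {ω | Z.dropped i t ω = true} = ENNReal.ofReal θ
  prob_bit : ∀ e t l, P {ω | Z.bit e t l ω = true} = ENNReal.ofReal a
  map_unif : ∀ i t l, P.map (Z.unif i t l) = volume.restrict (Set.Icc (0 : ℝ) 1)
  indep : iIndep Z.sigma P

/-- Stochastic quantization of `x` onto the grid `ℤ / c`: for `u` uniform on `[0, 1]` it rounds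
up to `(⌊c x⌋ + 1) / c` with probability `c x - ⌊c x⌋`, and down to `⌊c x⌋ / c` otherwise. -/
noncomputable def quantize (c u x : ℝ) : ℝ :=
  ((⌊c * x⌋ : ℝ) + if u < Int.fract (c * x) then 1 else 0) / c

namespace FedNoise

variable {N d : ℕ} {Ξ Ω : Type*}

/-- `D_i^{(t)}`: zero if user `i` drops out at time `t`, one otherwise. -/
def D (Z : FedNoise N d Ξ Ω) (i : Fin N) (t : ℕ) (ω : Ω) : ℝ :=
  if Z.dropped i t ω = true then 0 else 1

open Classical in
/-- `M_i^{(t)}(l)`: one if the selection bit of user `i` with some other user is one at `l`. -/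
noncomputable def M (Z : FedNoise N d Ξ Ω) (i : Fin N) (t : ℕ) (l : Fin d) (ω : Ω) : ℝ :=
  if ∃ j, j ≠ i ∧ Z.bit s(i, j) t l ω = true then 1 else 0

end FedNoise

namespace FedScheme

variable {N d : ℕ} {Ξ Ω : Type*}

/-- The probability `α / (N - 1)` that a pair of users selects a location. -/
noncomputable def pairProb (S : FedScheme N d Ξ) : ℝ := S.α / ((N : ℝ) - 1)

/-- The probability `p` that a user selects a location. -/
noncomputable def p (S : FedScheme N d Ξ) : ℝ := 1 - (1 - S.pairProb) ^ (N - 1)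

/-- `p' = (1 - θ) p`. -/
noncomputable def p' (S : FedScheme N d Ξ) : ℝ := (1 - S.θ) * S.p

/-- `p̃`: the probability that two given distinct users both participate at a location. -/
noncomputable def pTilde (S : FedScheme N d Ξ) : ℝ :=
  (1 - S.θ) ^ 2 *
    (1 - 2 * (1 - S.pairProb) ^ (N - 1) + (1 - S.pairProb) ^ (2 * N - 3))

/-- The local models `w_i^{(t)}`. If `E ∤ t + 1`, user `i` makes a local stochastic gradient step;
if `E ∣ t + 1`, with `t_o = t + 1 - E`, it replaces `w_i^{(t_o)}` by
`w_i^{(t_o)} - ∑_j D_j M_j Q((β_j / p') ∑_{k = t_o}^t z_j^{(k)})`, coordinate by coordinate.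
(See `localModel_succ_local` and `localModel_succ_sync`.) -/
noncomputable def localModel (S : FedScheme N d Ξ) (Z : FedNoise N d Ξ Ω) (ω : Ω) :
    ℕ → Fin N → Model d
  | 0 => fun _ => S.w₀
  | t + 1 =>
    if h : S.E ∣ t + 1 then fun i =>
      WithLp.toLp 2 fun l =>
        (localModel S Z ω (t + 1 - S.E) i) l -
          ∑ j, Z.D j t ω * Z.M j t l ω *
            quantize S.c (Z.unif j t l ω)
              (S.β j / S.p' * ∑ k ∈ (Finset.Icc (t + 1 - S.E) t).attach,
                (S.η k.1 • S.sg j (localModel S Z ω k.1 j) (Z.sample j k.1 ω)) l)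
    else fun i =>
      localModel S Z ω t i - S.η t • S.sg i (localModel S Z ω t i) (Z.sample i t ω)
  termination_by t => t
  decreasing_by
    · have := Nat.pos_of_dvd_of_pos h (Nat.succ_pos t)
      omega
    · have := (Finset.mem_Icc.1 k.2).2
      omega
    · omega

/-- The stochastic gradient `∇F_i(w_i^{(t)}, ξ_i^{(t)})` used by user `i` at time `t`. -/
noncomputable def stochGrad (S : FedScheme N d Ξ) (Z : FedNoise N d Ξ Ω) (i : Fin N) (t : ℕ)
    (ω : Ω) : Model d :=
  S.sg i (S.localModel Z ω t i) (Z.sample i t ω)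

/-- `z_i^{(t)} = η^{(t)} ∇F_i(w_i^{(t)}, ξ_i^{(t)})`. -/
noncomputable def z (S : FedScheme N d Ξ) (Z : FedNoise N d Ξ Ω) (i : Fin N) (t : ℕ)
    (ω : Ω) : Model d :=
  S.η t • S.stochGrad Z i t ω

/-- The average model `w̄^{(t)} = ∑_i β_i w_i^{(t)}`. -/
noncomputable def avgModel (S : FedScheme N d Ξ) (Z : FedNoise N d Ξ Ω) (t : ℕ) (ω : Ω) :
    Model d :=
  ∑ i, S.β i • S.localModel Z ω t i

theorem localModel_zero (S : FedScheme N d Ξ) (Z : FedNoise N d Ξ Ω) (ω : Ω) (i : Fin N) :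
    S.localModel Z ω 0 i = S.w₀ := by
  rw [localModel]

theorem localModel_succ_local (S : FedScheme N d Ξ) (Z : FedNoise N d Ξ Ω) (ω : Ω) (i : Fin N)
    {t : ℕ} (h : ¬ S.E ∣ t + 1) :
    S.localModel Z ω (t + 1) i = S.localModel Z ω t i - S.z Z i t ω := by
  rw [localModel, dif_neg h]
  rfl

theorem localModel_succ_sync (S : FedScheme N d Ξ) (Z : FedNoise N d Ξ Ω) (ω : Ω) (i : Fin N)
    {t : ℕ} (h : S.E ∣ t + 1) (l : Fin d) :
    S.localModel Z ω (t + 1) i l = S.localModel Z ω (t + 1 - S.E) i l -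
      ∑ j, Z.D j t ω * Z.M j t l ω *
        quantize S.c (Z.unif j t l ω)
          (S.β j / S.p' * ∑ k ∈ Finset.Icc (t + 1 - S.E) t, S.z Z j k ω l) := by
  rw [localModel, dif_pos h]
  simp only
  congr 1
  refine Finset.sum_congr rfl fun j _ => ?_
  rw [← Finset.sum_attach (Finset.Icc (t + 1 - S.E) t)]
  rfl

/-- The global objective `F = ∑_i β_i F_i`. -/
noncomputable def globalObj (S : FedScheme N d Ξ) (F : Fin N → Model d → ℝ) (w : Model d) : ℝ :=
  ∑ i, S.β i * F i w

/-- The heterogeneity `Γ = F* - ∑_i β_i F_i*`, where a star denotes the minimum value. -/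
noncomputable def heterogeneity (S : FedScheme N d Ξ) (F : Fin N → Model d → ℝ) : ℝ :=
  (⨅ w, S.globalObj F w) - ∑ i, S.β i * ⨅ w, F i w

/-- `B = ∑_i β_i² σ_i² + 6 L Γ + 8 (E - 1)² G²`. -/
noncomputable def constB (S : FedScheme N d Ξ) (F : Fin N → Model d → ℝ) (L G : ℝ)
    (σ : Fin N → ℝ) : ℝ :=
  ∑ i, S.β i ^ 2 * σ i ^ 2 + 6 * L * S.heterogeneity F + 8 * ((S.E : ℝ) - 1) ^ 2 * G ^ 2

/-- `C = N d p' / (4 c² (η^{(J-1)})²)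
  + 4 E² G² ∑_i (β_i² (1/p' - 1) + ∑_{j ≠ i} β_i β_j (p̃/p'² - 1))`. -/
noncomputable def constC (S : FedScheme N d Ξ) (G : ℝ) (J : ℕ) : ℝ :=
  (N : ℝ) * d * S.p' / (4 * S.c ^ 2 * S.η (J - 1) ^ 2) +
    4 * (S.E : ℝ) ^ 2 * G ^ 2 *
      ∑ i, (S.β i ^ 2 * (1 / S.p' - 1) +
        ∑ j ∈ Finset.univ.erase i, S.β i * S.β j * (S.pTilde / S.p' ^ 2 - 1))

end FedScheme

/-! ### Convexity, smoothness and the deterministic averaged gradient step -/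

section Convexity

variable {V : Type*} [NormedAddCommGroup V] [InnerProductSpace ℝ V]

/-! Let e_t be the expected squared distance from the average model to w*. The core is the one-step
bound e_{t+1} ≤ (1 - μ η_t) e_t + η_t² (B + C), which is `integral_norm_avgModel_succ_sub_sq_le`.
For η_t = 2/(μ(ν + t)) it forces e_t ≤ v/(ν + t), and since ∇F(w*) = 0, smoothness gives F(w) - F* ≤
(L/2)‖w - w*‖².

Local part (B). One averaged stochastic step, `descentStep`, differs from w* by U - R: U uses the
true gradients and depends only on the past, while R collects gradient errors that are centered
given the past. So the second moments add. R contributes ∑ β_i² σ_i². For U,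
`norm_averaged_gradient_step_sq_le` gives contraction up to 6Lη²Γ and twice the dispersion of the
local models. The dispersion is small because all users agree at multiples of E and make at most E -
1 local steps afterwards (`integral_dispersion_le`).

Synchronization part (C). Pathwise, synchronizing subtracts from `descentStep` a noise vector with
coordinates ∑_j (D_j M_j Q(x_j) - p' x_j), where p' x_j is the weighted accumulated gradient step of
user j. Rounding is unbiased, E[D_j M_j] = p', and both sources are independent of the samples drawn
so far, so this noise is orthogonal to the descent step. Its second moment splits into rounding
variances and participation covariances. The latter are nonnegative, because two users share a
selection bit, so every inner product of accumulated steps can be replaced by its upper bound.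

Initial term. The claimed rate has 8(L/μ)‖w₀ - w*‖² where the recursion needs ν‖w₀ - w*‖². When ν =
E is the larger, the gap is absorbed by B: strong convexity and the moment bound at time 0 give μ‖w₀
- w*‖ ≤ |G|, and B contains 8(E - 1)²G² (`mul_norm_sub_sq_le`).

All centering and orthogonality claims come from one mechanism: σ-algebras generated by disjoint
sets of `NoiseLabel`s are independent, and a variable independent of the rest may be integrated out
first. -/

theorem norm_sum_smul_sq_le {ι : Type*} [Fintype ι] {β : ι → ℝ} (hβ : ∀ i, 0 ≤ β i)
    (hsum : ∑ i, β i = 1) (v : ι → V) :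
    ‖∑ i, β i • v i‖ ^ 2 ≤ ∑ i, β i * ‖v i‖ ^ 2 := by
  have h := (convexOn_univ_norm (E := V)).pow (fun _ _ => norm_nonneg _) 2
  simpa using h.map_sum_le (t := Finset.univ) (w := β) (p := v) (fun i _ => hβ i) hsum (by simp)

/-- Parallel axis identity: the two sides differ by exactly the squared distance from the weighted
mean to `a`. It allows the dispersion to be measured from the last synchronized model. -/
theorem sum_mul_norm_sub_mean_sq_le {ι : Type*} [Fintype ι] {β : ι → ℝ}
    (hsum : ∑ i, β i = 1) (v : ι → V) (a : V) :
    ∑ i, β i * ‖(∑ j, β j • v j) - v i‖ ^ 2 ≤ ∑ i, β i * ‖v i - a‖ ^ 2 := by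
  set m := ∑ j, β j • v j with hm
  have key : ∀ i, β i * ‖v i - a‖ ^ 2 = β i * ‖m - v i‖ ^ 2 + β i * ‖m - a‖ ^ 2
      - 2 * (inner ℝ (m - a) (β i • m) - inner ℝ (m - a) (β i • v i)) := by
    intro i
    have : v i - a = (m - a) - (m - v i) := by abel
    rw [this, norm_sub_sq_real, ← inner_sub_right, ← smul_sub, inner_smul_right]
    ring
  have hz : ∑ i, (inner ℝ (m - a) (β i • m) - inner ℝ (m - a) (β i • v i)) = 0 := by
    rw [Finset.sum_sub_distrib, ← inner_sum, ← inner_sum, ← Finset.sum_smul, hsum, ← hm, one_smul,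
      sub_self]
  simp_rw [key]
  rw [Finset.sum_sub_distrib, Finset.sum_add_distrib, ← Finset.mul_sum, hz, ← Finset.sum_mul, hsum]
  nlinarith [sq_nonneg ‖m - a‖]

variable [CompleteSpace V]

/-- Write the strong convexity inequality along the segment from w to v, divide by the parameter t,
and let t decrease to 0. -/
theorem StrongConvexOn.add_inner_gradient_le {f : V → ℝ} {μ : ℝ}
    (hf : StrongConvexOn Set.univ μ f) (hd : Differentiable ℝ f) (v w : V) :
    f w + inner ℝ (gradient f w) (v - w) + μ / 2 * ‖v - w‖ ^ 2 ≤ f v := by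
  have hline : HasDerivAt (fun t : ℝ => f (w + t • (v - w))) (inner ℝ (gradient f w) (v - w)) 0 := by
    rw [inner_gradient_left]
    have h1 : HasDerivAt (fun t : ℝ => w + t • (v - w)) (v - w) 0 := by
      simpa using ((hasDerivAt_id (0 : ℝ)).smul_const (v - w)).const_add w
    have h2 : HasFDerivAt f (fderiv ℝ f w) (w + (0 : ℝ) • (v - w)) := by
      simpa using (hd w).hasFDerivAt
    exact h2.comp_hasDerivAt 0 h1
  have ht := hline.tendsto_slope_zero_right
  have hlim : Filter.Tendsto (fun t : ℝ => f v - f w - (1 - t) * (μ / 2 * ‖v - w‖ ^ 2))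
      (nhdsWithin 0 (Set.Ioi 0)) (nhds (f v - f w - (1 - 0) * (μ / 2 * ‖v - w‖ ^ 2))) := by
    apply tendsto_nhdsWithin_of_tendsto_nhds
    exact (Continuous.tendsto (by fun_prop) 0)
  have hle := le_of_tendsto_of_tendsto ht hlim (by
    have : Set.Ioo (0 : ℝ) 1 ∈ nhdsWithin 0 (Set.Ioi 0) := Ioo_mem_nhdsGT one_pos
    filter_upwards [this] with t ht
    have h := hf.2 (Set.mem_univ w) (Set.mem_univ v) (sub_nonneg.2 ht.2.le) ht.1.le (by ring)
    have e : (1 - t) • w + t • v = w + t • (v - w) := by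
      rw [sub_smul, one_smul, smul_sub]; abel
    rw [e, norm_sub_rev w v] at h
    simp only [smul_eq_mul, zero_add, zero_smul, add_zero] at h ⊢
    rw [inv_mul_le_iff₀ ht.1]
    nlinarith)
  linarith

/-- The first-order lower bound at 0 is a quadratic with positive leading coefficient; completing
the square bounds it. This makes the infima in Γ genuine. -/
theorem StrongConvexOn.bddBelow_range {f : V → ℝ} {μ : ℝ} (hμ : 0 < μ)
    (hf : StrongConvexOn Set.univ μ f) (hd : Differentiable ℝ f) : BddBelow (Set.range f) := by
  refine ⟨f 0 - ‖gradient f 0‖ ^ 2 / (2 * μ), ?_⟩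
  rintro _ ⟨v, rfl⟩
  have h := hf.add_inner_gradient_le hd v 0
  rw [sub_zero] at h
  have h2 := neg_le_of_abs_le (abs_real_inner_le_norm (gradient f 0) v)
  have h3 : ‖gradient f 0‖ * ‖v‖ ≤ ‖gradient f 0‖ ^ 2 / (2 * μ) + μ / 2 * ‖v‖ ^ 2 := by
    have : ‖gradient f 0‖ ^ 2 / (2 * μ) + μ / 2 * ‖v‖ ^ 2 - ‖gradient f 0‖ * ‖v‖
        = (‖gradient f 0‖ - μ * ‖v‖) ^ 2 / (2 * μ) := by field_simp; ring
    have h4 : 0 ≤ (‖gradient f 0‖ - μ * ‖v‖) ^ 2 / (2 * μ) := by positivity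
    linarith
  linarith

/-- Evaluate the quadratic upper bound at its own minimizer w - L⁻¹∇f(w): the guaranteed decrease
cannot exceed the gap to the infimum. -/
theorem norm_gradient_sq_le {f : V → ℝ} {L : ℝ} (hL : 0 < L)
    (hf : ∀ v w : V, f v ≤ f w + inner ℝ (gradient f w) (v - w) + L / 2 * ‖v - w‖ ^ 2)
    (hb : BddBelow (Set.range f)) (w : V) :
    ‖gradient f w‖ ^ 2 ≤ 2 * L * (f w - ⨅ v, f v) := by
  have h1 := ciInf_le hb (w - L⁻¹ • gradient f w)
  have h2 := hf (w - L⁻¹ • gradient f w) w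
  have e : w - L⁻¹ • gradient f w - w = -(L⁻¹ • gradient f w) := by abel
  rw [e, inner_neg_right, inner_smul_right, real_inner_self_eq_norm_sq, norm_neg, norm_smul,
    Real.norm_of_nonneg (inv_nonneg.2 hL.le)] at h2
  have h3 : L / 2 * (L⁻¹ * ‖gradient f w‖) ^ 2 = L⁻¹ * ‖gradient f w‖ ^ 2 / 2 := by
    field_simp
  have h4 : L⁻¹ * ‖gradient f w‖ ^ 2 ≤ 2 * (f w - ⨅ v, f v) := by linarith
  rw [inv_mul_le_iff₀ hL] at h4
  linarith

/-- One averaged gradient step, computed at scattered points, contracts towards the minimizer up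
to heterogeneity and dispersion. -/
theorem norm_averaged_gradient_step_sq_le {ι : Type*} [Fintype ι] {β : ι → ℝ}
    (hβ : ∀ i, 0 ≤ β i) (hsum : ∑ i, β i = 1) {f : ι → V → ℝ} {L μ η : ℝ} (hL : 0 < L) (hμ : 0 < μ)
    (hd : ∀ i, Differentiable ℝ (f i))
    (hsm : ∀ i, ∀ v w : V,
      f i v ≤ f i w + inner ℝ (gradient (f i) w) (v - w) + L / 2 * ‖v - w‖ ^ 2)
    (hsc : ∀ i, StrongConvexOn Set.univ μ (f i)) (hη : 0 < η) (hηL : 4 * L * η ≤ 1)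
    (s : V) (hs : ∀ v, ∑ i, β i * f i s ≤ ∑ i, β i * f i v) (w : ι → V) :
    ‖(∑ i, β i • w i) - η • (∑ i, β i • gradient (f i) (w i)) - s‖ ^ 2 ≤
      (1 - μ * η) * ‖(∑ i, β i • w i) - s‖ ^ 2
        + 6 * L * η ^ 2 * (∑ i, β i * f i s - ∑ i, β i * ⨅ v, f i v)
        + 2 * ∑ i, β i * ‖(∑ j, β j • w j) - w i‖ ^ 2 := by
  set x := ∑ i, β i • w i with hx
  have hb : ∀ i, BddBelow (Set.range (f i)) := fun i => (hsc i).bddBelow_range hμ (hd i)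
  -- After the first-order estimates, -γ is the coefficient of f_i(w_i): 4Lη² from two uses of the
  -- gradient bound, -2η from strong convexity.
  set γ := 2 * η - 4 * L * η ^ 2 with hγ
  have hγ0 : 0 ≤ γ := by rw [hγ]; nlinarith
  have hγ1 : γ ≤ 2 * η := by rw [hγ]; nlinarith [mul_pos hL (sq_pos_of_pos hη)]
  have key : ∀ i, η ^ 2 * ‖gradient (f i) (w i)‖ ^ 2 - 2 * η * inner ℝ (x - s) (gradient (f i) (w i))
      ≤ 2 * ‖x - w i‖ ^ 2 - μ * η * ‖w i - s‖ ^ 2 - γ * (1 - η * L) * f i x + 2 * η * f i s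
        - (4 * L * η ^ 2 + γ * (η * L)) * ⨅ v, f i v := by
    intro i
    have a1 := norm_gradient_sq_le hL (hsm i) (hb i) (w i)
    have a2 := norm_gradient_sq_le hL (hsm i) (hb i) x
    have a3 := (hsc i).add_inner_gradient_le (hd i) s (w i)
    have a4 := (hsc i).add_inner_gradient_le (hd i) (w i) x
    have a5 : 0 ≤ ‖(x - w i) + η • gradient (f i) (w i)‖ ^ 2 := sq_nonneg _
    have a6 : 0 ≤ ‖(w i - x) + η • gradient (f i) x‖ ^ 2 := sq_nonneg _
    rw [norm_add_sq_real, inner_smul_right, norm_smul, Real.norm_of_nonneg hη.le] at a5 a6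
    have e1 : inner ℝ (x - s) (gradient (f i) (w i)) =
        inner ℝ (x - w i) (gradient (f i) (w i)) - inner ℝ (gradient (f i) (w i)) (s - w i) := by
      rw [real_inner_comm (s - w i), ← inner_sub_left]; congr 1; abel
    rw [norm_sub_rev s (w i)] at a3
    rw [norm_sub_rev (w i) x] at a4 a6
    rw [real_inner_comm] at a6
    rw [e1]
    generalize inner ℝ (gradient (f i) (w i)) (s - w i) = A at *
    generalize inner ℝ (x - w i) (gradient (f i) (w i)) = B at *
    generalize inner ℝ (gradient (f i) x) (w i - x) = C at *
    generalize ‖gradient (f i) (w i)‖ = g at *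
    generalize ‖gradient (f i) x‖ = k at *
    generalize (⨅ v, f i v) = m at *
    generalize ‖x - w i‖ = r at *
    generalize ‖w i - s‖ = q at *
    -- The inner product with x - w_i is split off by Young's inequality (`a5`), costing r² and a
    -- second η²g²; both η²g² are at most 2Lη²(f_i(w_i) - m).
    have b1 : η ^ 2 * g ^ 2 - 2 * η * (B - A) ≤ 4 * L * η ^ 2 * (f i (w i) - m) + r ^ 2
        - 2 * η * (f i (w i) - f i s) - μ * η * q ^ 2 := by
      nlinarith [mul_le_mul_of_nonneg_left a1 (sq_nonneg η), mul_le_mul_of_nonneg_left a3 hη.le]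
    -- Moves from f_i(w_i) to f_i(x), where x is the mean, because only at a common point can
    -- minimality of s for the weighted sum be used. Scaling by γ/η ≤ 2 then costs another r²,
    -- whence the factor 2 on the dispersion.
    have b2 : η * (f i x - η * L * (f i x - m)) - r ^ 2 / 2 ≤ η * f i (w i) := by
      nlinarith [mul_le_mul_of_nonneg_left a2 (sq_nonneg η), mul_le_mul_of_nonneg_left a4 hη.le,
        mul_nonneg (mul_nonneg hη.le hμ.le) (sq_nonneg r)]
    have b3 : γ * (f i x - η * L * (f i x - m)) - r ^ 2 ≤ γ * f i (w i) := by
      have c := mul_le_mul_of_nonneg_left b2 (div_nonneg hγ0 hη.le)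
      have c1 : γ / η * (η * (f i x - η * L * (f i x - m)) - r ^ 2 / 2) =
          γ * (f i x - η * L * (f i x - m)) - γ / η * (r ^ 2 / 2) := by field_simp
      have c2 : γ / η * (η * f i (w i)) = γ * f i (w i) := by field_simp
      have c3 : γ / η ≤ 2 := by rw [div_le_iff₀ hη]; exact hγ1
      nlinarith [mul_le_mul_of_nonneg_right c3 (by positivity : 0 ≤ r ^ 2 / 2)]
    nlinarith
  have hsumkey := Finset.sum_le_sum fun i (_ : i ∈ Finset.univ) =>
    mul_le_mul_of_nonneg_left (key i) (hβ i)
  have hg := norm_sum_smul_sq_le hβ hsum fun i => gradient (f i) (w i)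
  have hw : ‖x - s‖ ^ 2 ≤ ∑ i, β i * ‖w i - s‖ ^ 2 := by
    have := norm_sum_smul_sq_le hβ hsum fun i => w i - s
    simpa only [smul_sub, Finset.sum_sub_distrib, ← Finset.sum_smul, hsum, one_smul, ← hx] using this
  have hin : ∑ i, β i * inner ℝ (x - s) (gradient (f i) (w i)) =
      inner ℝ (x - s) (∑ i, β i • gradient (f i) (w i)) := by
    rw [inner_sum]; simp only [inner_smul_right]
  have e1 : ∑ i, β i * (η ^ 2 * ‖gradient (f i) (w i)‖ ^ 2
      - 2 * η * inner ℝ (x - s) (gradient (f i) (w i))) =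
      η ^ 2 * ∑ i, β i * ‖gradient (f i) (w i)‖ ^ 2
      - 2 * η * inner ℝ (x - s) (∑ i, β i • gradient (f i) (w i)) := by
    rw [← hin, Finset.mul_sum, Finset.mul_sum, ← Finset.sum_sub_distrib]
    exact Finset.sum_congr rfl fun i _ => by ring
  have e2 : ∑ i, β i * (2 * ‖x - w i‖ ^ 2 - μ * η * ‖w i - s‖ ^ 2 - γ * (1 - η * L) * f i x
      + 2 * η * f i s - (4 * L * η ^ 2 + γ * (η * L)) * ⨅ v, f i v) =
      2 * ∑ i, β i * ‖x - w i‖ ^ 2 - μ * η * ∑ i, β i * ‖w i - s‖ ^ 2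
      - γ * (1 - η * L) * ∑ i, β i * f i x + 2 * η * ∑ i, β i * f i s
      - (4 * L * η ^ 2 + γ * (η * L)) * ∑ i, β i * ⨅ v, f i v := by
    simp only [Finset.mul_sum, ← Finset.sum_sub_distrib, ← Finset.sum_add_distrib]
    exact Finset.sum_congr rfl fun i _ => by ring
  rw [e1, e2] at hsumkey
  have hΓ : ∑ i, β i * (⨅ v, f i v) ≤ ∑ i, β i * f i s :=
    Finset.sum_le_sum fun i _ => mul_le_mul_of_nonneg_left (ciInf_le (hb i) s) (hβ i)
  have hsx := hs x
  have e3 : x - η • (∑ i, β i • gradient (f i) (w i)) - s =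
      (x - s) - η • (∑ i, β i • gradient (f i) (w i)) := by abel
  rw [e3, norm_sub_sq_real, inner_smul_right, norm_smul, Real.norm_of_nonneg hη.le, mul_pow]
  have c1 := mul_le_mul_of_nonneg_left hg (sq_nonneg η)
  have c2 := mul_le_mul_of_nonneg_left hw (mul_pos hμ hη).le
  have hηL' : 0 ≤ 1 - η * L := by nlinarith [mul_pos hη hL]
  have c3 := mul_le_mul_of_nonneg_left hsx (mul_nonneg hγ0 hηL')
  -- The heterogeneity coefficient is 4Lη² + γηL, and γ ≤ 2η yields the constant 6.
  have c4 : γ * (η * L) * (∑ i, β i * f i s - ∑ i, β i * ⨅ v, f i v) ≤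
      2 * L * η ^ 2 * (∑ i, β i * f i s - ∑ i, β i * ⨅ v, f i v) := by
    apply mul_le_mul_of_nonneg_right _ (sub_nonneg.2 hΓ)
    nlinarith [mul_le_mul_of_nonneg_right hγ1 (mul_pos hη hL).le]
  have e4 : γ * (1 - η * L) = 2 * η - 4 * L * η ^ 2 - γ * (η * L) := by rw [hγ]; ring
  rw [e4] at c3 hsumkey
  linarith

/-- Add the first-order inequalities from s to w and from w to s, then apply Cauchy–Schwarz. -/
theorem StrongConvexOn.mul_norm_sub_le_norm_gradient {f : V → ℝ} {μ : ℝ}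
    (hf : StrongConvexOn Set.univ μ f) (hd : Differentiable ℝ f) {s : V}
    (hs : gradient f s = 0) (w : V) : μ * ‖w - s‖ ≤ ‖gradient f w‖ := by
  have h1 := hf.add_inner_gradient_le hd w s
  have h2 := hf.add_inner_gradient_le hd s w
  rw [hs, inner_zero_left] at h1
  rw [norm_sub_rev s w] at h2
  have h3 := neg_le_of_abs_le (abs_real_inner_le_norm (gradient f w) (s - w))
  rw [norm_sub_rev s w] at h3
  rcases (norm_nonneg (w - s)).eq_or_lt with h | h
  · rw [← h, mul_zero]; exact norm_nonneg _
  · have : μ * ‖w - s‖ * ‖w - s‖ ≤ ‖gradient f w‖ * ‖w - s‖ := by nlinarith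
    exact le_of_mul_le_mul_right this h

end Convexity

/-- The `O(1/t)` rate of a recursion with decreasing steps `2 / (μ (ν + t))`. -/
theorem le_div_of_contraction_recursion {Δ : ℕ → ℝ} {J : ℕ} {μ ν K v : ℝ} (hμ : 0 < μ) (hν : 2 ≤ ν)
    (hv0 : ν * Δ 0 ≤ v) (hv : 0 ≤ v) (hvK : 4 * K / μ ^ 2 ≤ v)
    (hΔ : ∀ t < J, Δ (t + 1) ≤
      (1 - μ * (2 / (μ * (ν + t)))) * Δ t + (2 / (μ * (ν + t))) ^ 2 * K) :
    ∀ t ≤ J, Δ t ≤ v / (ν + t) := by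
  intro t
  induction t with
  | zero => intro _; rw [Nat.cast_zero, add_zero, le_div_iff₀ (by linarith)]; linarith
  | succ t ih =>
    intro ht
    have h1 := hΔ t ht
    have h2 := ih (by omega)
    have hs : 2 ≤ ν + t := by linarith [(Nat.cast_nonneg t : (0 : ℝ) ≤ t)]
    push_cast
    rw [← add_assoc]
    set s := ν + (t : ℝ)
    have hs0 : 0 < s := by linarith
    have e1 : μ * (2 / (μ * s)) = 2 / s := by field_simp
    have e2 : (2 / (μ * s)) ^ 2 * K = 4 * K / μ ^ 2 / s ^ 2 := by field_simp; ring
    rw [e1, e2] at h1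
    -- The condition 2 ≤ ν enters here: the contraction factor must be nonnegative for the induction
    -- hypothesis to be multiplied by it.
    have h3 : 2 / s ≤ 1 := by rw [div_le_one hs0]; exact hs
    have h4 : (1 - 2 / s) * Δ t ≤ (1 - 2 / s) * (v / s) :=
      mul_le_mul_of_nonneg_left h2 (by linarith)
    have h5 : 4 * K / μ ^ 2 / s ^ 2 ≤ v / s ^ 2 := div_le_div_of_nonneg_right hvK (by positivity)
    have h6 : (1 - 2 / s) * (v / s) + v / s ^ 2 = v / (s + 1) - v / (s ^ 2 * (s + 1)) := by
      field_simp; ring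
    have h7 : 0 ≤ v / (s ^ 2 * (s + 1)) := by positivity
    linarith

/-- Freezing: independence makes the joint law a product, and Fubini integrates Y out with X held
fixed. It is applied to rounding variables and to samples. -/
theorem integral_comp_eq_integral_integral_of_indep {Ω A B : Type*} {m mΩ : MeasurableSpace Ω}
    [MeasurableSpace A] [mB : MeasurableSpace B] {P : Measure Ω} [IsProbabilityMeasure P]
    (hm : m ≤ mΩ) {X : Ω → A} {Y : Ω → B} (hX : Measurable[m] X)
    (hY : Measurable Y) (hind : Indep m (mB.comap Y) P) {f : A → B → ℝ}
    (hf : Measurable (Function.uncurry f)) (hint : Integrable (fun ω => f (X ω) (Y ω)) P) :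
    ∫ ω, f (X ω) (Y ω) ∂P = ∫ ω, ∫ y, f (X ω) y ∂(P.map Y) ∂P := by
  have hX' : Measurable X := hX.mono hm le_rfl
  have hXY : IndepFun X Y P := indep_of_indep_of_le_left hind hX.comap_le
  have hmap := (indepFun_iff_map_prod_eq_prod_map_map hX'.aemeasurable hY.aemeasurable).1 hXY
  have : IsProbabilityMeasure (P.map Y) := Measure.isProbabilityMeasure_map hY.aemeasurable
  have : IsProbabilityMeasure (P.map X) := Measure.isProbabilityMeasure_map hX'.aemeasurable
  have h1 : Integrable (Function.uncurry f) ((P.map X).prod (P.map Y)) := by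
    rw [← hmap, integrable_map_measure hf.aestronglyMeasurable (hX'.prodMk hY).aemeasurable]
    exact hint
  calc ∫ ω, f (X ω) (Y ω) ∂P
      = ∫ z, Function.uncurry f z ∂(P.map fun ω => (X ω, Y ω)) :=
        (integral_map (hX'.prodMk hY).aemeasurable hf.aestronglyMeasurable).symm
    _ = ∫ x, ∫ y, f x y ∂(P.map Y) ∂(P.map X) := by rw [hmap, integral_prod _ h1]; rfl
    _ = _ := integral_map hX'.aemeasurable h1.aestronglyMeasurable.integral_prod_right'

/-! ### The stochastic quantizer -/

section Quantize

theorem measurable_quantize (c : ℝ) : Measurable fun q : ℝ × ℝ => quantize c q.1 q.2 := by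
  unfold quantize
  have h1 : Measurable fun q : ℝ × ℝ => c * q.2 := measurable_snd.const_mul c
  have h2 : Measurable fun q : ℝ × ℝ => ((⌊c * q.2⌋ : ℤ) : ℝ) :=
    measurable_from_top.comp (Int.measurable_floor.comp h1)
  exact (h2.add (Measurable.ite (measurableSet_lt measurable_fst (measurable_fract.comp h1))
    measurable_const measurable_const)).div_const c

theorem measurable_quantize_comp {Ω : Type*} {m : MeasurableSpace Ω} (c : ℝ) {u x : Ω → ℝ}
    (hu : Measurable u) (hx : Measurable x) : Measurable fun ω => quantize c (u ω) (x ω) := by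
  have h := (measurable_quantize c).comp (hu.prodMk hx)
  exact h

/-- For uniform u the error is a centered Bernoulli variable divided by c, whose parameter is the
fractional part φ of cx. Unbiasedness and the variance φ(1 - φ)/c² ≤ 1/(4c²) are read off from this
form. -/
theorem quantize_sub {c : ℝ} (hc : 0 < c) (u x : ℝ) :
    quantize c u x - x = ((if u < Int.fract (c * x) then 1 else 0) - Int.fract (c * x)) / c := by
  have h := Int.floor_add_fract (c * x)
  rw [quantize, eq_div_iff hc.ne', sub_mul, div_mul_cancel₀ _ hc.ne']
  linarith

theorem abs_quantize_sub_le {c : ℝ} (hc : 0 < c) (u x : ℝ) : |quantize c u x - x| ≤ 1 / c := by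
  rw [quantize_sub hc, abs_div, abs_of_pos hc]
  refine div_le_div_of_nonneg_right ?_ hc.le
  have h0 := Int.fract_nonneg (c * x)
  have h1 := (Int.fract_lt_one (c * x)).le
  rw [abs_le]
  split_ifs <;> constructor <;> linarith

theorem integral_ite_lt {φ : ℝ} (h0 : 0 ≤ φ) (h1 : φ ≤ 1) :
    ∫ u in Set.Icc (0 : ℝ) 1, (if u < φ then (1 : ℝ) else 0) = φ := by
  have : (fun u : ℝ => if u < φ then (1 : ℝ) else 0) = (Set.Iio φ).indicator 1 := by
    ext u; simp [Set.indicator_apply]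
  have e : Set.Iio φ ∩ Set.Icc 0 1 = Set.Ico 0 φ := by
    ext u; simp only [Set.mem_inter_iff, Set.mem_Iio, Set.mem_Icc, Set.mem_Ico]
    constructor
    · rintro ⟨a, b, _⟩; exact ⟨b, a⟩
    · rintro ⟨a, b⟩; exact ⟨b, a, by linarith⟩
  rw [this, integral_indicator_one measurableSet_Iio, Measure.real,
    Measure.restrict_apply measurableSet_Iio, e, Real.volume_Ico, sub_zero, ENNReal.toReal_ofReal h0]

theorem integrable_ite_lt (φ : ℝ) :
    Integrable (fun u : ℝ => if u < φ then (1 : ℝ) else 0) (volume.restrict (Set.Icc (0 : ℝ) 1)) := by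
  refine Integrable.of_bound (C := 1) (Measurable.ite measurableSet_Iio measurable_const
    measurable_const).aestronglyMeasurable (Filter.Eventually.of_forall fun u => ?_)
  split_ifs <;> simp

theorem integral_quantize_sub {c : ℝ} (hc : 0 < c) (x : ℝ) :
    ∫ u in Set.Icc (0 : ℝ) 1, (quantize c u x - x) = 0 := by
  simp_rw [quantize_sub hc]
  rw [integral_div, integral_sub (integrable_ite_lt _) (integrable_const _),
    integral_ite_lt (Int.fract_nonneg _) (Int.fract_lt_one _).le]
  simp

theorem integral_quantize_sub_sq_le {c : ℝ} (hc : 0 < c) (x : ℝ) :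
    ∫ u in Set.Icc (0 : ℝ) 1, (quantize c u x - x) ^ 2 ≤ 1 / (4 * c ^ 2) := by
  set φ := Int.fract (c * x) with hφ
  have h : ∀ u, (quantize c u x - x) ^ 2 =
      ((if u < φ then 1 else 0) * (1 - 2 * φ) + φ ^ 2) / c ^ 2 := by
    intro u
    rw [quantize_sub hc, div_pow]
    congr 1
    split_ifs <;> ring
  simp_rw [h]
  rw [integral_div, integral_add ((integrable_ite_lt _).mul_const _) (integrable_const _),
    integral_mul_const, integral_ite_lt (Int.fract_nonneg _) (Int.fract_lt_one _).le]
  have e : (1 : ℝ) / (4 * c ^ 2) = (1 / 4) / c ^ 2 := by field_simp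
  rw [e]
  refine div_le_div_of_nonneg_right ?_ (by positivity)
  simp only [integral_const, measureReal_restrict_apply_univ, Real.volume_real_Icc, smul_eq_mul]
  norm_num
  nlinarith [sq_nonneg (2 * φ - 1)]

end Quantize

/-! ### Label sets: past, drawn samples, participation -/

namespace NoiseLabel

variable {N d : ℕ}

/-- The time of a random variable. -/
def time : NoiseLabel N d → ℕ
  | sample _ t => t
  | dropped _ t => t
  | bit _ t _ => t
  | unif _ t _ => t

/-- The random variables of times before `t`. -/
def past (N d t : ℕ) : Set (NoiseLabel N d) := {a | a.time < t}

/-- The random variables of times before `t`, and the samples of time `t`. -/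
def drawn (N d t : ℕ) : Set (NoiseLabel N d) := past N d t ∪ Set.range fun i => sample i t

/-- The random variables that decide which users contribute at time `t`. -/
def participation (N d t : ℕ) : Set (NoiseLabel N d) :=
  (Set.range fun i => dropped i t) ∪ Set.range fun q : Sym2 (Fin N) × Fin d => bit q.1 t q.2

theorem past_subset_drawn {t : ℕ} : past N d t ⊆ drawn N d t := Set.subset_union_left

theorem past_mono {s t : ℕ} (h : s ≤ t) : past N d s ⊆ past N d t :=
  fun _ ha => lt_of_lt_of_le ha h

theorem drawn_subset_past {s t : ℕ} (h : s < t) : drawn N d s ⊆ past N d t := by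
  rintro a (ha | ⟨i, rfl⟩)
  · exact past_mono h.le ha
  · exact h

theorem participation_subset_past {s t : ℕ} (h : s < t) : participation N d s ⊆ past N d t := by
  rintro a (⟨i, rfl⟩ | ⟨i, rfl⟩) <;> exact h

theorem disjoint_drawn_participation {t : ℕ} : Disjoint (drawn N d t) (participation N d t) := by
  rw [Set.disjoint_left]
  rintro _ (ha | ⟨i, rfl⟩) (⟨j, hj⟩ | ⟨j, hj⟩)
  · subst hj; exact lt_irrefl t ha
  · subst hj; exact lt_irrefl t ha
  · exact nomatch hj
  · exact nomatch hj

end NoiseLabel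

/-! ### Participation variables and the σ-algebras of label sets -/

namespace FedNoise

variable {N d : ℕ} {Ξ Ω : Type*}

/-- One minus the selection bit of a pair of users. -/
def unselected (Z : FedNoise N d Ξ Ω) (e : Sym2 (Fin N)) (t : ℕ) (l : Fin d) (ω : Ω) : ℝ :=
  if Z.bit e t l ω = true then 0 else 1

/-- The pairs of users that contain `i`. -/
def pairsAt (i : Fin N) : Finset (Sym2 (Fin N)) := (Finset.univ.erase i).image fun j => s(i, j)

theorem mem_pairsAt {i : Fin N} {e : Sym2 (Fin N)} : e ∈ pairsAt i ↔ i ∈ e ∧ ¬ e.IsDiag := by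
  induction e with | _ x y
  simp only [pairsAt, Finset.mem_image, Finset.mem_erase, Finset.mem_univ, and_true, Sym2.mem_iff,
    Sym2.mk_isDiag_iff]
  constructor
  · rintro ⟨j, hj, h⟩
    rcases Sym2.eq_iff.1 h with ⟨rfl, rfl⟩ | ⟨rfl, rfl⟩
    · exact ⟨Or.inl rfl, hj.symm⟩
    · exact ⟨Or.inr rfl, hj⟩
  · rintro ⟨rfl | rfl, h⟩
    · exact ⟨y, Ne.symm h, rfl⟩
    · exact ⟨x, h, Sym2.eq_swap⟩

theorem card_pairsAt (i : Fin N) : (pairsAt i).card = N - 1 := by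
  rw [pairsAt, Finset.card_image_of_injective _ fun j k h => Sym2.congr_right.1 h,
    Finset.card_erase_of_mem (Finset.mem_univ i), Finset.card_univ, Fintype.card_fin]

/-- The stars of i and j have N - 1 edges each and share only the edge {i, j}; this is the origin of
the exponent 2N - 3. -/
theorem card_pairsAt_union {i j : Fin N} (h : i ≠ j) :
    (pairsAt i ∪ pairsAt j).card = 2 * N - 3 := by
  have hinter : pairsAt i ∩ pairsAt j = {s(i, j)} := by
    ext e
    rw [Finset.mem_inter, mem_pairsAt, mem_pairsAt, Finset.mem_singleton,
      ← Sym2.mem_and_mem_iff h]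
    refine ⟨fun ⟨⟨a, _⟩, b, _⟩ => ⟨a, b⟩, fun ⟨a, b⟩ => ?_⟩
    have hd : ¬ e.IsDiag := by
      rw [(Sym2.mem_and_mem_iff h).1 ⟨a, b⟩, Sym2.mk_isDiag_iff]
      exact h
    exact ⟨⟨a, hd⟩, b, hd⟩
  have h1 := Finset.card_union_add_card_inter (pairsAt i) (pairsAt j)
  rw [hinter, Finset.card_singleton, card_pairsAt, card_pairsAt] at h1
  omega

/-- Not selecting is a product of independent factors, one per pair, so expectations factor; `M`
itself has no such form. -/
theorem one_sub_M (Z : FedNoise N d Ξ Ω) (i : Fin N) (t : ℕ) (l : Fin d) (ω : Ω) :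
    1 - Z.M i t l ω = ∏ e ∈ pairsAt i, Z.unselected e t l ω := by
  unfold M unselected
  split_ifs with h
  · obtain ⟨j, hj, hb⟩ := h
    rw [sub_self, Finset.prod_eq_zero (i := s(i, j))]
    · exact Finset.mem_image_of_mem _ (by simp [hj])
    · rw [if_pos hb]
  · rw [sub_zero, Finset.prod_eq_one]
    intro e he
    obtain ⟨j, hj, rfl⟩ := Finset.mem_image.1 he
    rw [if_neg fun hb => h ⟨j, Finset.ne_of_mem_erase hj, hb⟩]

/-- The product `D_i M_i(l)`. -/
noncomputable def contrib (Z : FedNoise N d Ξ Ω) (i : Fin N) (t : ℕ) (l : Fin d) (ω : Ω) : ℝ :=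
  Z.D i t ω * Z.M i t l ω

theorem contrib_eq_zero_or_one (Z : FedNoise N d Ξ Ω) (i : Fin N) (t : ℕ) (l : Fin d) (ω : Ω) :
    Z.contrib i t l ω = 0 ∨ Z.contrib i t l ω = 1 := by
  unfold contrib D M
  split_ifs <;> simp

theorem contrib_nonneg (Z : FedNoise N d Ξ Ω) (i : Fin N) (t : ℕ) (l : Fin d) (ω : Ω) :
    0 ≤ Z.contrib i t l ω := by
  rcases Z.contrib_eq_zero_or_one i t l ω with h | h <;> rw [h]; norm_num

theorem abs_contrib_le (Z : FedNoise N d Ξ Ω) (i : Fin N) (t : ℕ) (l : Fin d) (ω : Ω) :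
    |Z.contrib i t l ω| ≤ 1 := by
  rcases Z.contrib_eq_zero_or_one i t l ω with h | h <;> rw [h] <;> simp

theorem contrib_mul_self (Z : FedNoise N d Ξ Ω) (i : Fin N) (t : ℕ) (l : Fin d) (ω : Ω) :
    Z.contrib i t l ω * Z.contrib i t l ω = Z.contrib i t l ω := by
  rcases Z.contrib_eq_zero_or_one i t l ω with h | h <;> rw [h] <;> simp

variable [MeasurableSpace Ξ]

/-- The σ-algebra generated by the random variables with labels in `T`. -/
@[reducible] def sigmaOn (Z : FedNoise N d Ξ Ω) (T : Set (NoiseLabel N d)) : MeasurableSpace Ω :=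
  ⨆ a ∈ T, Z.sigma a

theorem sigmaOn_mono (Z : FedNoise N d Ξ Ω) {T T' : Set (NoiseLabel N d)} (h : T ⊆ T') :
    Z.sigmaOn T ≤ Z.sigmaOn T' :=
  biSup_mono h

theorem sigma_le_sigmaOn (Z : FedNoise N d Ξ Ω) {T : Set (NoiseLabel N d)} {a : NoiseLabel N d}
    (h : a ∈ T) : Z.sigma a ≤ Z.sigmaOn T :=
  le_biSup Z.sigma h

theorem measurable_sample_sigmaOn (Z : FedNoise N d Ξ Ω) {T : Set (NoiseLabel N d)} {i : Fin N}
    {t : ℕ} (h : .sample i t ∈ T) : Measurable[Z.sigmaOn T] (Z.sample i t) :=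
  (comap_measurable (Z.sample i t)).mono (Z.sigma_le_sigmaOn h) le_rfl

theorem measurable_unif_sigmaOn (Z : FedNoise N d Ξ Ω) {T : Set (NoiseLabel N d)} {i : Fin N}
    {t : ℕ} {l : Fin d} (h : .unif i t l ∈ T) : Measurable[Z.sigmaOn T] (Z.unif i t l) :=
  (comap_measurable (Z.unif i t l)).mono (Z.sigma_le_sigmaOn h) le_rfl

theorem measurable_D_sigmaOn (Z : FedNoise N d Ξ Ω) {T : Set (NoiseLabel N d)} {i : Fin N}
    {t : ℕ} (h : .dropped i t ∈ T) : Measurable[Z.sigmaOn T] (Z.D i t) := by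
  have h1 : Measurable[Z.sigmaOn T] (Z.dropped i t) :=
    (comap_measurable (Z.dropped i t)).mono (Z.sigma_le_sigmaOn h) le_rfl
  exact (measurable_of_countable fun b : Bool => if b = true then (0 : ℝ) else 1).comp h1

theorem measurable_unselected_sigmaOn (Z : FedNoise N d Ξ Ω) {T : Set (NoiseLabel N d)}
    {e : Sym2 (Fin N)} {t : ℕ} {l : Fin d} (h : .bit e t l ∈ T) :
    Measurable[Z.sigmaOn T] (Z.unselected e t l) := by
  have h1 : Measurable[Z.sigmaOn T] (Z.bit e t l) :=
    (comap_measurable (Z.bit e t l)).mono (Z.sigma_le_sigmaOn h) le_rfl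
  exact (measurable_of_countable fun b : Bool => if b = true then (0 : ℝ) else 1).comp h1

theorem measurable_contrib_sigmaOn (Z : FedNoise N d Ξ Ω) (i : Fin N) (t : ℕ) (l : Fin d) :
    Measurable[Z.sigmaOn (NoiseLabel.participation N d t)] (Z.contrib i t l) := by
  have h : Z.contrib i t l = fun ω =>
      Z.D i t ω * (1 - ∏ e ∈ pairsAt i, Z.unselected e t l ω) := by
    ext ω; rw [← one_sub_M, contrib]; ring
  rw [h]
  refine (Z.measurable_D_sigmaOn (Or.inl ⟨i, rfl⟩)).mul (measurable_const.sub ?_)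
  exact Finset.measurable_fun_prod _ fun e _ =>
    Z.measurable_unselected_sigmaOn (Or.inr ⟨(e, l), rfl⟩)

end FedNoise

/-! ### Independence, rounding moments and participation probabilities -/

namespace FedNoise.HasJointLaw

variable {N d : ℕ} {Ξ Ω : Type*} [MeasurableSpace Ξ] [mΩ : MeasurableSpace Ω]
  {Z : FedNoise N d Ξ Ω} {P : Measure Ω} {𝒟 : Fin N → Measure Ξ} {θ a : ℝ}

theorem sigma_le (hZ : Z.HasJointLaw P 𝒟 θ a) (b : NoiseLabel N d) : Z.sigma b ≤ mΩ := by
  cases b with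
  | sample i t => exact (hZ.measurable_sample i t).comap_le
  | dropped i t => exact (hZ.measurable_dropped i t).comap_le
  | bit e t l => exact (hZ.measurable_bit e t l).comap_le
  | unif i t l => exact (hZ.measurable_unif i t l).comap_le

theorem sigmaOn_le (hZ : Z.HasJointLaw P 𝒟 θ a) (T : Set (NoiseLabel N d)) : Z.sigmaOn T ≤ mΩ :=
  iSup₂_le fun b _ => hZ.sigma_le b

theorem indep_sigmaOn (hZ : Z.HasJointLaw P 𝒟 θ a) {T T' : Set (NoiseLabel N d)}
    (h : Disjoint T T') : Indep (Z.sigmaOn T) (Z.sigmaOn T') P :=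
  indep_iSup_of_disjoint hZ.sigma_le hZ.indep h

theorem indep_sigmaOn_sigma (hZ : Z.HasJointLaw P 𝒟 θ a) {T : Set (NoiseLabel N d)}
    {b : NoiseLabel N d} (h : b ∉ T) : Indep (Z.sigmaOn T) (Z.sigma b) P :=
  indep_of_indep_of_le_right (hZ.indep_sigmaOn (Set.disjoint_singleton_right.2 h))
    (Z.sigma_le_sigmaOn rfl)

theorem measurable_of_sigmaOn (hZ : Z.HasJointLaw P 𝒟 θ a) {T : Set (NoiseLabel N d)} {B : Type*}
    [MeasurableSpace B] {f : Ω → B} (hf : Measurable[Z.sigmaOn T] f) : Measurable f :=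
  hf.mono (hZ.sigmaOn_le T) le_rfl

theorem measurable_contrib (hZ : Z.HasJointLaw P 𝒟 θ a) (i : Fin N) (t : ℕ) (l : Fin d) :
    Measurable (Z.contrib i t l) :=
  hZ.measurable_of_sigmaOn (Z.measurable_contrib_sigmaOn i t l)

theorem measurable_rounding (hZ : Z.HasJointLaw P 𝒟 θ a) (c : ℝ) (i : Fin N) (t : ℕ) (l : Fin d)
    {X : Ω → ℝ} (hX : Measurable X) :
    Measurable fun ω => quantize c (Z.unif i t l ω) (X ω) - X ω :=
  ((measurable_quantize c).comp ((hZ.measurable_unif i t l).prodMk hX)).sub hX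

theorem integrable_mul_rounding (hZ : Z.HasJointLaw P 𝒟 θ a) {c : ℝ} (hc : 0 < c) (i : Fin N)
    (t : ℕ) (l : Fin d) {X W : Ω → ℝ} (hX : Measurable X) (hW : Integrable W P) :
    Integrable (fun ω => W ω * (quantize c (Z.unif i t l ω) (X ω) - X ω)) P :=
  hW.mul_bdd (c := 1 / c) (hZ.measurable_rounding c i t l hX).aestronglyMeasurable
    (Filter.Eventually.of_forall fun _ => abs_quantize_sub_le hc _ _)

variable [IsProbabilityMeasure P]

/-- With W and X frozen, the uniform variable is integrated out and the quantizer is unbiased. The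
set T may contain the rounding variables of other users, which gives their mutual orthogonality. -/
theorem integral_mul_rounding (hZ : Z.HasJointLaw P 𝒟 θ a) {c : ℝ} (hc : 0 < c) {i : Fin N}
    {t : ℕ} {l : Fin d} {T : Set (NoiseLabel N d)} (hT : .unif i t l ∉ T) {X W : Ω → ℝ}
    (hX : Measurable[Z.sigmaOn T] X) (hW : Measurable[Z.sigmaOn T] W) (hWi : Integrable W P) :
    ∫ ω, W ω * (quantize c (Z.unif i t l ω) (X ω) - X ω) ∂P = 0 := by
  have h := integral_comp_eq_integral_integral_of_indep (P := P) (hZ.sigmaOn_le T)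
    (X := fun ω => (W ω, X ω)) (Y := Z.unif i t l) (hW.prodMk hX) (hZ.measurable_unif i t l)
    (hZ.indep_sigmaOn_sigma hT) (f := fun q u => q.1 * (quantize c u q.2 - q.2))
    (by
      refine (measurable_fst.comp measurable_fst).mul (Measurable.sub ?_
        (measurable_snd.comp measurable_fst))
      exact (measurable_quantize c).comp
        (measurable_snd.prodMk (measurable_snd.comp measurable_fst)))
    (hZ.integrable_mul_rounding hc i t l (hZ.measurable_of_sigmaOn hX) hWi)
  simp only [hZ.map_unif, integral_const_mul, integral_quantize_sub hc, mul_zero,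
    integral_zero] at h
  exact h

/-- The weight W stays inside the expectation: with W equal to a participation indicator it
contributes its mean p' rather than 1. -/
theorem integral_mul_rounding_sq_le (hZ : Z.HasJointLaw P 𝒟 θ a) {c : ℝ} (hc : 0 < c) {i : Fin N}
    {t : ℕ} {l : Fin d} {T : Set (NoiseLabel N d)} (hT : .unif i t l ∉ T) {X W : Ω → ℝ}
    (hX : Measurable[Z.sigmaOn T] X) (hW : Measurable[Z.sigmaOn T] W) (hWi : Integrable W P)
    (hW0 : ∀ ω, 0 ≤ W ω) :
    ∫ ω, W ω * (quantize c (Z.unif i t l ω) (X ω) - X ω) ^ 2 ∂P ≤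
      1 / (4 * c ^ 2) * ∫ ω, W ω ∂P := by
  have h := integral_comp_eq_integral_integral_of_indep (P := P) (hZ.sigmaOn_le T)
    (X := fun ω => (W ω, X ω)) (Y := Z.unif i t l) (hW.prodMk hX) (hZ.measurable_unif i t l)
    (hZ.indep_sigmaOn_sigma hT) (f := fun q u => q.1 * (quantize c u q.2 - q.2) ^ 2)
    (by
      refine (measurable_fst.comp measurable_fst).mul (Measurable.pow_const (Measurable.sub ?_
        (measurable_snd.comp measurable_fst)) 2)
      exact (measurable_quantize c).comp
        (measurable_snd.prodMk (measurable_snd.comp measurable_fst)))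
    (by
      have h1 := hZ.integrable_mul_rounding hc i t l (hZ.measurable_of_sigmaOn hX)
        (hZ.integrable_mul_rounding hc i t l (hZ.measurable_of_sigmaOn hX) hWi)
      simpa only [mul_assoc, ← pow_two] using h1)
  simp only [hZ.map_unif, integral_const_mul] at h
  rw [h, ← integral_const_mul]
  refine integral_mono_of_nonneg (Filter.Eventually.of_forall fun ω => mul_nonneg (hW0 ω)
    (integral_nonneg fun _ => sq_nonneg _)) (hWi.const_mul _)
    (Filter.Eventually.of_forall fun ω => ?_)
  dsimp only
  rw [mul_comm (1 / (4 * c ^ 2))]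
  exact mul_le_mul_of_nonneg_left (integral_quantize_sub_sq_le hc _) (hW0 ω)

theorem integral_D (hZ : Z.HasJointLaw P 𝒟 θ a) (hθ : 0 ≤ θ) (i : Fin N) (t : ℕ) :
    ∫ ω, Z.D i t ω ∂P = 1 - θ := by
  have hm : MeasurableSet {ω | Z.dropped i t ω = true} :=
    hZ.measurable_dropped i t (measurableSet_singleton true)
  have h : Z.D i t = fun ω => 1 - {ω | Z.dropped i t ω = true}.indicator 1 ω := by
    ext ω
    by_cases hω : Z.dropped i t ω = true <;> simp [D, hω]
  rw [h, integral_sub (integrable_const _) ((integrable_const _).indicator hm),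
    integral_indicator_one hm, Measure.real, hZ.prob_dropped, ENNReal.toReal_ofReal hθ]
  simp

theorem integral_unselected (hZ : Z.HasJointLaw P 𝒟 θ a) (ha : 0 ≤ a) (e : Sym2 (Fin N)) (t : ℕ)
    (l : Fin d) : ∫ ω, Z.unselected e t l ω ∂P = 1 - a := by
  have hm : MeasurableSet {ω | Z.bit e t l ω = true} :=
    hZ.measurable_bit e t l (measurableSet_singleton true)
  have h : Z.unselected e t l = fun ω => 1 - {ω | Z.bit e t l ω = true}.indicator 1 ω := by
    ext ω
    by_cases hω : Z.bit e t l ω = true <;> simp [unselected, hω]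
  rw [h, integral_sub (integrable_const _) ((integrable_const _).indicator hm),
    integral_indicator_one hm, Measure.real, hZ.prob_bit, ENNReal.toReal_ofReal ha]
  simp

/-- The factors carry distinct labels, hence are independent. Both participation moments below are
linear combinations of such products. -/
theorem integral_prod_D_mul_prod_unselected (hZ : Z.HasJointLaw P 𝒟 θ a) (hθ : 0 ≤ θ) (ha : 0 ≤ a)
    (T : Finset (Fin N)) (S : Finset (Sym2 (Fin N))) (t : ℕ) (l : Fin d) :
    ∫ ω, (∏ i ∈ T, Z.D i t ω) * ∏ e ∈ S, Z.unselected e t l ω ∂P =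
      (1 - θ) ^ T.card * (1 - a) ^ S.card := by
  let g : T ⊕ S → NoiseLabel N d := Sum.elim (fun i => .dropped i t) fun e => .bit e t l
  let X : T ⊕ S → Ω → ℝ := Sum.elim (fun i => Z.D i t) fun e => Z.unselected e t l
  have hg : Function.Injective g := by
    rintro (x | x) (y | y) h
    · exact congrArg Sum.inl (Subtype.ext (NoiseLabel.dropped.inj h).1)
    · exact nomatch h
    · exact nomatch h
    · exact congrArg Sum.inr (Subtype.ext (NoiseLabel.bit.inj h).1)
  have hX : ∀ x, Measurable[Z.sigmaOn {g x}] (X x) := by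
    rintro (x | x)
    · exact Z.measurable_D_sigmaOn rfl
    · exact Z.measurable_unselected_sigmaOn rfl
  have hX' : ∀ x, Measurable (X x) := fun x => hZ.measurable_of_sigmaOn (hX x)
  have hind : iIndepFun X P := by
    rw [iIndepFun_iff_iIndep]
    refine iIndep_of_iIndep_of_le (hZ.indep.precomp hg) fun x => ?_
    refine (hX x).comap_le.trans ?_
    exact iSup₂_le fun b hb => by rw [Set.mem_singleton_iff.1 hb]; rfl
  have h := hind.integral_fun_prod_eq_prod_integral fun x => (hX' x).aestronglyMeasurable
  simp only [Fintype.prod_sum_type, X, Sum.elim_inl, Sum.elim_inr, hZ.integral_D hθ,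
    hZ.integral_unselected ha, Finset.prod_const, Finset.card_univ, Fintype.card_coe] at h
  rw [← h]
  congr 1
  ext ω
  rw [← Finset.prod_coe_sort T, ← Finset.prod_coe_sort S]

theorem integrable_prod_D_mul_prod_unselected (hZ : Z.HasJointLaw P 𝒟 θ a)
    (T : Finset (Fin N)) (S : Finset (Sym2 (Fin N))) (t : ℕ) (l : Fin d) :
    Integrable (fun ω => (∏ i ∈ T, Z.D i t ω) * ∏ e ∈ S, Z.unselected e t l ω) P := by
  refine Integrable.of_bound (C := 1) (Measurable.aestronglyMeasurable ?_)
    (Filter.Eventually.of_forall fun ω => ?_)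
  · refine Measurable.mul (Finset.measurable_fun_prod _ fun i _ => ?_)
      (Finset.measurable_fun_prod _ fun e _ => ?_)
    · exact hZ.measurable_of_sigmaOn (Z.measurable_D_sigmaOn (Set.mem_univ _))
    · exact hZ.measurable_of_sigmaOn (Z.measurable_unselected_sigmaOn (Set.mem_univ _))
  · rw [norm_mul, norm_prod, norm_prod]
    refine mul_le_one₀ (Finset.prod_le_one (fun _ _ => norm_nonneg _) fun i _ => ?_)
      (Finset.prod_nonneg fun _ _ => norm_nonneg _)
      (Finset.prod_le_one (fun _ _ => norm_nonneg _) fun e _ => ?_)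
    · unfold D; split_ifs <;> simp
    · unfold unselected; split_ifs <;> simp

theorem integral_contrib (hZ : Z.HasJointLaw P 𝒟 θ a) (hθ : 0 ≤ θ) (ha : 0 ≤ a) (i : Fin N)
    (t : ℕ) (l : Fin d) :
    ∫ ω, Z.contrib i t l ω ∂P = (1 - θ) * (1 - (1 - a) ^ (N - 1)) := by
  have h : Z.contrib i t l = fun ω =>
      (∏ k ∈ {i}, Z.D k t ω) * (∏ e ∈ ∅, Z.unselected e t l ω) -
      (∏ k ∈ {i}, Z.D k t ω) * ∏ e ∈ pairsAt i, Z.unselected e t l ω := by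
    ext ω
    rw [← one_sub_M, Finset.prod_singleton, Finset.prod_empty, contrib]
    ring
  rw [h, integral_sub (hZ.integrable_prod_D_mul_prod_unselected _ _ _ _)
    (hZ.integrable_prod_D_mul_prod_unselected _ _ _ _),
    hZ.integral_prod_D_mul_prod_unselected hθ ha, hZ.integral_prod_D_mul_prod_unselected hθ ha,
    card_pairsAt, Finset.card_singleton, Finset.card_empty]
  ring

/-- Inclusion–exclusion: expand M_i M_j in the complements 1 - M_i and 1 - M_j and integrate each
product. -/
theorem integral_contrib_mul_contrib (hZ : Z.HasJointLaw P 𝒟 θ a) (hθ : 0 ≤ θ) (ha : 0 ≤ a)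
    {i j : Fin N} (hij : i ≠ j) (t : ℕ) (l : Fin d) :
    ∫ ω, Z.contrib i t l ω * Z.contrib j t l ω ∂P =
      (1 - θ) ^ 2 * (1 - 2 * (1 - a) ^ (N - 1) + (1 - a) ^ (2 * N - 3)) := by
  have hprod : ∀ (S : Finset (Sym2 (Fin N))) ω, ∏ e ∈ S, Z.unselected e t l ω =
      if ∀ e ∈ S, ¬ Z.bit e t l ω = true then 1 else 0 := by
    intro S ω
    split_ifs with h
    · exact Finset.prod_eq_one fun e he => if_neg (h e he)
    · push Not at h
      obtain ⟨e, he, hb⟩ := h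
      exact Finset.prod_eq_zero he (if_pos hb)
  -- The bit of {i, j} occurs in both products, but its factor is 0 or 1 and hence idempotent, so it
  -- is counted once in the union.
  have hun : ∀ ω, (1 - Z.M i t l ω) * (1 - Z.M j t l ω) =
      ∏ e ∈ pairsAt i ∪ pairsAt j, Z.unselected e t l ω := by
    intro ω
    rw [one_sub_M, one_sub_M, hprod, hprod, hprod]
    simp only [Finset.forall_mem_union, ite_and, mul_ite, mul_one, mul_zero]
    split_ifs <;> rfl
  have h : (fun ω => Z.contrib i t l ω * Z.contrib j t l ω) = fun ω =>
      ((∏ k ∈ {i, j}, Z.D k t ω) * (∏ e ∈ ∅, Z.unselected e t l ω) -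
      (∏ k ∈ {i, j}, Z.D k t ω) * (∏ e ∈ pairsAt i, Z.unselected e t l ω) -
      (∏ k ∈ {i, j}, Z.D k t ω) * ∏ e ∈ pairsAt j, Z.unselected e t l ω) +
      (∏ k ∈ {i, j}, Z.D k t ω) * ∏ e ∈ pairsAt i ∪ pairsAt j, Z.unselected e t l ω := by
    ext ω
    rw [← hun, ← one_sub_M, ← one_sub_M, Finset.prod_pair hij, Finset.prod_empty, contrib, contrib]
    ring
  have hI := fun T S => hZ.integrable_prod_D_mul_prod_unselected T S t l
  rw [h, integral_add ?_ (hI _ _), integral_sub ?_ (hI _ _), integral_sub (hI _ _) (hI _ _)]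
  rotate_left
  · exact (hI _ _).sub (hI _ _)
  · exact ((hI _ _).sub (hI _ _)).sub (hI _ _)
  simp only [hZ.integral_prod_D_mul_prod_unselected hθ ha, card_pairsAt, card_pairsAt_union hij,
    Finset.card_pair hij, Finset.card_empty]
  ring

/-- With the iterate W and the direction V frozen, the fresh sample is averaged out and unbiasedness
makes the inner integral vanish. -/
theorem integral_inner_sub_gradient (hZ : Z.HasJointLaw P 𝒟 θ a) {g : Model d → Ξ → Model d}
    (hg : Measurable (Function.uncurry g)) {h : Model d → Model d} (hh : Measurable h)
    {i : Fin N} {t : ℕ} (hgh : ∀ w, Integrable (g w) (𝒟 i) ∧ ∫ x, g w x ∂(𝒟 i) = h w)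
    {T : Set (NoiseLabel N d)} (hT : .sample i t ∉ T) {W V : Ω → Model d}
    (hW : Measurable[Z.sigmaOn T] W) (hV : Measurable[Z.sigmaOn T] V)
    (hint : Integrable (fun ω => inner ℝ (V ω) (g (W ω) (Z.sample i t ω) - h (W ω))) P) :
    ∫ ω, inner ℝ (V ω) (g (W ω) (Z.sample i t ω) - h (W ω)) ∂P = 0 := by
  have h1 := integral_comp_eq_integral_integral_of_indep (P := P) (hZ.sigmaOn_le T)
    (X := fun ω => (V ω, W ω)) (Y := Z.sample i t) (hV.prodMk hW) (hZ.measurable_sample i t)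
    (hZ.indep_sigmaOn_sigma hT) (f := fun q x => inner ℝ q.1 (g q.2 x - h q.2))
    (by
      refine (measurable_fst.comp measurable_fst).inner (Measurable.sub ?_
        (hh.comp (measurable_snd.comp measurable_fst)))
      exact hg.comp ((measurable_snd.comp measurable_fst).prodMk measurable_snd))
    hint
  have hp : IsProbabilityMeasure (𝒟 i) := by
    rw [← hZ.map_sample i t]
    exact Measure.isProbabilityMeasure_map (hZ.measurable_sample i t).aemeasurable
  rw [h1, hZ.map_sample]
  refine (integral_congr_ae (Filter.Eventually.of_forall fun ω => ?_)).trans (integral_zero _ _)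
  dsimp only
  have hz : ∫ x, (g (W ω) x - h (W ω)) ∂(𝒟 i) = 0 := by
    rw [integral_sub (hgh _).1 (integrable_const _), (hgh _).2]
    simp
  have hi : Integrable (fun x => g (W ω) x - h (W ω)) (𝒟 i) :=
    (hgh _).1.sub (integrable_const _)
  rw [integral_inner hi, hz, inner_zero_right]

end FedNoise.HasJointLaw

/-! ### Second-moment calculus in L² -/

section SquareIntegrable

variable {Ω V : Type*} {mΩ : MeasurableSpace Ω} {P : Measure Ω}
  [NormedAddCommGroup V]

theorem MeasureTheory.MemLp.integrable_norm_sq {f : Ω → V} (hf : MemLp f 2 P) :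
    Integrable (fun ω => ‖f ω‖ ^ 2) P :=
  (memLp_two_iff_integrable_sq_norm hf.1).1 hf

theorem norm_sum_sq_le_card_mul {ι : Type*} (s : Finset ι) (v : ι → V) :
    ‖∑ i ∈ s, v i‖ ^ 2 ≤ s.card * ∑ i ∈ s, ‖v i‖ ^ 2 :=
  (pow_le_pow_left₀ (norm_nonneg _) (norm_sum_le s v) 2).trans sq_sum_le_card_mul_sum_sq

theorem integral_norm_sum_sq_le {ι : Type*} (s : Finset ι) {v : ι → Ω → V} {b : ℝ}
    (hv : ∀ i ∈ s, MemLp (v i) 2 P) (hb : ∀ i ∈ s, ∫ ω, ‖v i ω‖ ^ 2 ∂P ≤ b) :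
    ∫ ω, ‖∑ i ∈ s, v i ω‖ ^ 2 ∂P ≤ (s.card : ℝ) ^ 2 * b := by
  have hi : ∀ i ∈ s, Integrable (fun ω => ‖v i ω‖ ^ 2) P := fun i h => (hv i h).integrable_norm_sq
  calc ∫ ω, ‖∑ i ∈ s, v i ω‖ ^ 2 ∂P
      ≤ ∫ ω, s.card * ∑ i ∈ s, ‖v i ω‖ ^ 2 ∂P :=
        integral_mono (memLp_finsetSum s hv).integrable_norm_sq
          ((integrable_finsetSum _ hi).const_mul _) fun ω => norm_sum_sq_le_card_mul s _
    _ = s.card * ∑ i ∈ s, ∫ ω, ‖v i ω‖ ^ 2 ∂P := by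
        rw [integral_const_mul, integral_finsetSum _ hi]
    _ ≤ s.card * (s.card * b) := by
        refine mul_le_mul_of_nonneg_left ?_ (Nat.cast_nonneg _)
        simpa using Finset.sum_le_sum hb
    _ = _ := by ring

variable [InnerProductSpace ℝ V]

theorem MeasureTheory.MemLp.integrable_real_inner {f g : Ω → V} (hf : MemLp f 2 P)
    (hg : MemLp g 2 P) : Integrable (fun ω => inner ℝ (f ω) (g ω)) P :=
  (hf.norm.integrable_mul hg.norm).mono' (hf.1.inner hg.1)
    (Filter.Eventually.of_forall fun ω => by
      simpa only [Pi.mul_apply, Real.norm_eq_abs] using abs_real_inner_le_norm (f ω) (g ω))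

theorem integral_norm_sub_sq_of_integral_inner_eq_zero {f g : Ω → V} (hf : MemLp f 2 P)
    (hg : MemLp g 2 P) (h : ∫ ω, inner ℝ (f ω) (g ω) ∂P = 0) :
    ∫ ω, ‖f ω - g ω‖ ^ 2 ∂P = ∫ ω, ‖f ω‖ ^ 2 ∂P + ∫ ω, ‖g ω‖ ^ 2 ∂P := by
  simp_rw [norm_sub_sq_real]
  rw [integral_add ?_ hg.integrable_norm_sq, integral_sub hf.integrable_norm_sq, integral_const_mul,
    h, mul_zero, sub_zero]
  · exact (hf.integrable_real_inner hg).const_mul 2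
  · exact hf.integrable_norm_sq.sub ((hf.integrable_real_inner hg).const_mul 2)

theorem integral_norm_sum_smul_sq_of_pairwise {ι : Type*} [Fintype ι] {e : ι → Ω → V}
    (he : ∀ i, MemLp (e i) 2 P) (h : ∀ i j, i ≠ j → ∫ ω, inner ℝ (e i ω) (e j ω) ∂P = 0)
    (c : ι → ℝ) :
    ∫ ω, ‖∑ i, c i • e i ω‖ ^ 2 ∂P = ∑ i, c i ^ 2 * ∫ ω, ‖e i ω‖ ^ 2 ∂P := by
  simp_rw [← real_inner_self_eq_norm_sq, sum_inner, inner_sum, inner_smul_left, inner_smul_right]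
  have hint : ∀ i j, Integrable (fun ω =>
      (starRingEnd ℝ) (c i) * (c j * inner ℝ (e i ω) (e j ω))) P :=
    fun i j => (((he i).integrable_real_inner (he j)).const_mul _).const_mul _
  rw [integral_finsetSum _ fun i _ => integrable_finsetSum _ fun j _ => hint i j]
  refine Finset.sum_congr rfl fun i _ => ?_
  rw [integral_finsetSum _ fun j _ => hint i j, Finset.sum_eq_single i]
  · rw [integral_const_mul, integral_const_mul]
    simp only [conj_trivial]
    ring
  · intro j _ hj
    rw [integral_const_mul, integral_const_mul, h i j hj.symm, mul_zero, mul_zero]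
  · simp

theorem integral_inner_le_of_integral_norm_sq_le {f g : Ω → V} (hf : MemLp f 2 P) (hg : MemLp g 2 P)
    {b : ℝ} (hfb : ∫ ω, ‖f ω‖ ^ 2 ∂P ≤ b) (hgb : ∫ ω, ‖g ω‖ ^ 2 ∂P ≤ b) :
    ∫ ω, inner ℝ (f ω) (g ω) ∂P ≤ b := by
  have h : ∫ ω, inner ℝ (f ω) (g ω) ∂P ≤ ∫ ω, (‖f ω‖ ^ 2 + ‖g ω‖ ^ 2) / 2 ∂P := by
    refine integral_mono (hf.integrable_real_inner hg)
      ((hf.integrable_norm_sq.add hg.integrable_norm_sq).div_const 2) fun ω => ?_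
    have := real_inner_le_norm (f ω) (g ω)
    dsimp only
    nlinarith [sq_nonneg (‖f ω‖ - ‖g ω‖)]
  rw [integral_div, integral_add hf.integrable_norm_sq hg.integrable_norm_sq] at h
  linarith

end SquareIntegrable

/-! ### Mean and variance of the aggregation noise at one location -/

namespace FedNoise

variable {N d : ℕ} {Ξ Ω : Type*}

/-- The deviation, at one location, of the quantized and sparsified aggregate of the values `x j`
from its mean. -/
noncomputable def aggregationNoise (Z : FedNoise N d Ξ Ω) (c r : ℝ) (t : ℕ) (l : Fin d)
    (x : Fin N → Ω → ℝ) (ω : Ω) : ℝ :=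
  ∑ j, (Z.contrib j t l ω * quantize c (Z.unif j t l ω) (x j ω) - r * x j ω)

/-- The error of the quantization of `x` by user `j`. -/
noncomputable def rounding (Z : FedNoise N d Ξ Ω) (c : ℝ) (t : ℕ) (l : Fin d)
    (x : Ω → ℝ) (j : Fin N) (ω : Ω) : ℝ :=
  quantize c (Z.unif j t l ω) (x ω) - x ω

/-- The two sums are centered for different reasons: the first by the rounding variables, the second
by dropout and selection. -/
theorem aggregationNoise_eq (Z : FedNoise N d Ξ Ω) (c r : ℝ) (t : ℕ) (l : Fin d)
    (x : Fin N → Ω → ℝ) (ω : Ω) :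
    Z.aggregationNoise c r t l x ω = ∑ j, Z.contrib j t l ω * Z.rounding c t l (x j) j ω +
      ∑ j, (Z.contrib j t l ω - r) * x j ω := by
  rw [aggregationNoise, ← Finset.sum_add_distrib]
  exact Finset.sum_congr rfl fun j _ => by unfold rounding; ring

namespace HasJointLaw

variable [MeasurableSpace Ξ] {Z : FedNoise N d Ξ Ω} {c r : ℝ} {t : ℕ} {l : Fin d}
  {x : Fin N → Ω → ℝ}

theorem measurable_rounding_sigmaOn {T : Set (NoiseLabel N d)} {j : Fin N}
    (hT : .unif j t l ∈ T) {x : Ω → ℝ} (hx : Measurable[Z.sigmaOn T] x) :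
    Measurable[Z.sigmaOn T] (Z.rounding c t l x j) :=
  ((measurable_quantize c).comp ((Z.measurable_unif_sigmaOn hT).prodMk hx)).sub hx

theorem contrib_measurable_compl_unif (i j : Fin N) :
    Measurable[Z.sigmaOn {NoiseLabel.unif i t l}ᶜ] (Z.contrib j t l) := by
  refine (Z.measurable_contrib_sigmaOn j t l).mono (Z.sigmaOn_mono ?_) le_rfl
  rintro _ (⟨k, rfl⟩ | ⟨k, rfl⟩) h <;> exact nomatch h

theorem measurable_compl_unif_of_drawn (i : Fin N) {x : Ω → ℝ}
    (hx : Measurable[Z.sigmaOn (NoiseLabel.drawn N d t)] x) :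
    Measurable[Z.sigmaOn {NoiseLabel.unif i t l}ᶜ] x := by
  refine hx.mono (Z.sigmaOn_mono ?_) le_rfl
  rintro _ (h | ⟨k, rfl⟩) h'
  · rw [Set.mem_singleton_iff.1 h'] at h
    exact lt_irrefl t h
  · exact nomatch h'

variable [mΩ : MeasurableSpace Ω] {P : Measure Ω} {𝒟 : Fin N → Measure Ξ} {θ a : ℝ}

theorem integral_mul_of_drawn_of_participation (hZ : Z.HasJointLaw P 𝒟 θ a) {A X : Ω → ℝ}
    (hA : Measurable[Z.sigmaOn (NoiseLabel.participation N d t)] A)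
    (hX : Measurable[Z.sigmaOn (NoiseLabel.drawn N d t)] X) :
    ∫ ω, A ω * X ω ∂P = (∫ ω, A ω ∂P) * ∫ ω, X ω ∂P := by
  have h : IndepFun A X P := indep_of_indep_of_le
    (hZ.indep_sigmaOn NoiseLabel.disjoint_drawn_participation.symm) hA.comap_le hX.comap_le
  exact h.integral_fun_mul_eq_mul_integral (hZ.measurable_of_sigmaOn hA).aestronglyMeasurable
    (hZ.measurable_of_sigmaOn hX).aestronglyMeasurable

theorem integrable_contrib_mul (hZ : Z.HasJointLaw P 𝒟 θ a) (i : Fin N) {W : Ω → ℝ}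
    (hW : Integrable W P) : Integrable (fun ω => Z.contrib i t l ω * W ω) P :=
  hW.bdd_mul (c := 1) (hZ.measurable_contrib i t l).aestronglyMeasurable
    (Filter.Eventually.of_forall fun _ => abs_contrib_le _ _ _ _ _)

theorem integrable_centered_contrib_mul (hZ : Z.HasJointLaw P 𝒟 θ a) (i : Fin N) {W : Ω → ℝ}
    (hW : Integrable W P) : Integrable (fun ω => (Z.contrib i t l ω - r) * W ω) P := by
  simp only [sub_mul]
  exact (hZ.integrable_contrib_mul i hW).sub (hW.const_mul r)

theorem memLp_contrib_mul (hZ : Z.HasJointLaw P 𝒟 θ a) (i : Fin N) {W : Ω → ℝ}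
    (hW : MemLp W 2 P) : MemLp (fun ω => Z.contrib i t l ω * W ω) 2 P := by
  refine hW.of_le ((hZ.measurable_contrib i t l).aestronglyMeasurable.mul hW.1)
    (Filter.Eventually.of_forall fun ω => ?_)
  rw [norm_mul]
  exact mul_le_of_le_one_left (norm_nonneg _) (abs_contrib_le _ _ _ _ _)

variable [IsProbabilityMeasure P]

theorem memLp_rounding (hZ : Z.HasJointLaw P 𝒟 θ a) (hc : 0 < c) {x : Ω → ℝ} (hx : Measurable x)
    (j : Fin N) : MemLp (Z.rounding c t l x j) 2 P :=
  MemLp.of_bound (hZ.measurable_rounding c j t l hx).aestronglyMeasurable (1 / c)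
    (Filter.Eventually.of_forall fun _ => abs_quantize_sub_le hc _ _)

theorem memLp_aggregationNoise (hZ : Z.HasJointLaw P 𝒟 θ a) (hc : 0 < c)
    (hx : ∀ j, Measurable (x j)) (hx2 : ∀ j, MemLp (x j) 2 P) :
    MemLp (Z.aggregationNoise c r t l x) 2 P := by
  have e : Z.aggregationNoise c r t l x = fun ω =>
      ∑ j, (Z.contrib j t l ω * (Z.rounding c t l (x j) j ω + x j ω) - r * x j ω) := by
    ext ω
    simp [aggregationNoise, rounding]
  rw [e]
  refine memLp_finsetSum _ fun j _ => ?_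
  have h1 : MemLp (fun ω => Z.rounding c t l (x j) j ω + x j ω) 2 P :=
    (hZ.memLp_rounding hc (hx j) j).add (hx2 j)
  exact (hZ.memLp_contrib_mul j h1).sub ((hx2 j).const_mul r)

/-- Rounding errors are centered given everything else. -/
theorem integral_mul_rounding_compl (hZ : Z.HasJointLaw P 𝒟 θ a) (hc : 0 < c) {i : Fin N}
    {X W : Ω → ℝ} (hX : Measurable[Z.sigmaOn (NoiseLabel.drawn N d t)] X)
    (hW : Measurable[Z.sigmaOn {NoiseLabel.unif i t l}ᶜ] W) (hWi : Integrable W P) :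
    ∫ ω, W ω * Z.rounding c t l X i ω ∂P = 0 :=
  hZ.integral_mul_rounding hc (by simp) (measurable_compl_unif_of_drawn i hX) hW hWi

theorem integrable_contrib (hZ : Z.HasJointLaw P 𝒟 θ a) (i : Fin N) :
    Integrable (Z.contrib i t l) P := by
  simpa using hZ.integrable_contrib_mul (t := t) (l := l) i (integrable_const (1 : ℝ))

/-- The rounding part vanishes when the uniforms are integrated out, and the participation part
because its centered coefficients are independent of the drawn samples, on which V and the x_j
depend. -/
theorem integral_mul_aggregationNoise (hZ : Z.HasJointLaw P 𝒟 θ a) (hc : 0 < c)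
    (hr : ∀ j, ∫ ω, Z.contrib j t l ω ∂P = r)
    (hx : ∀ j, Measurable[Z.sigmaOn (NoiseLabel.drawn N d t)] (x j))
    (hx2 : ∀ j, MemLp (x j) 2 P) {V : Ω → ℝ}
    (hV : Measurable[Z.sigmaOn (NoiseLabel.drawn N d t)] V) (hV2 : MemLp V 2 P) :
    ∫ ω, V ω * Z.aggregationNoise c r t l x ω ∂P = 0 := by
  have hVi : Integrable V P := hV2.integrable (by norm_num)
  have h1 : ∀ j, Integrable (fun ω =>
      (Z.contrib j t l ω * V ω) * Z.rounding c t l (x j) j ω) P := fun j =>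
    hZ.integrable_mul_rounding hc j t l (hZ.measurable_of_sigmaOn (hx j))
      (hZ.integrable_contrib_mul j hVi)
  have h2 : ∀ j, Integrable (fun ω => (Z.contrib j t l ω - r) * (V ω * x j ω)) P := fun j =>
    hZ.integrable_centered_contrib_mul j (hV2.integrable_mul (hx2 j))
  have e : ∀ ω, V ω * Z.aggregationNoise c r t l x ω =
      ∑ j, (Z.contrib j t l ω * V ω) * Z.rounding c t l (x j) j ω +
      ∑ j, (Z.contrib j t l ω - r) * (V ω * x j ω) := by
    intro ω
    rw [aggregationNoise_eq, mul_add, Finset.mul_sum, Finset.mul_sum]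
    congr 1 <;> exact Finset.sum_congr rfl fun j _ => by ring
  simp_rw [e]
  rw [integral_add (integrable_finsetSum _ fun j _ => h1 j)
    (integrable_finsetSum _ fun j _ => h2 j), integral_finsetSum _ fun j _ => h1 j,
    integral_finsetSum _ fun j _ => h2 j, Finset.sum_eq_zero, Finset.sum_eq_zero, add_zero]
  · intro j _
    rw [hZ.integral_mul_of_drawn_of_participation (A := fun ω => Z.contrib j t l ω - r)
      (X := fun ω => V ω * x j ω) ((Z.measurable_contrib_sigmaOn j t l).sub_const r) (hV.mul (hx j)),
      integral_sub (hZ.integrable_contrib j) (integrable_const _), hr j]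
    simp
  · intro j _
    exact hZ.integral_mul_rounding_compl hc (hx j) ((contrib_measurable_compl_unif j j).mul
      (measurable_compl_unif_of_drawn j hV)) (hZ.integrable_contrib_mul j hVi)

theorem integral_rounding_sum_sq_le (hZ : Z.HasJointLaw P 𝒟 θ a) (hc : 0 < c)
    (hr : ∀ j, ∫ ω, Z.contrib j t l ω ∂P = r)
    (hx : ∀ j, Measurable[Z.sigmaOn (NoiseLabel.drawn N d t)] (x j)) :
    ∫ ω, (∑ j, Z.contrib j t l ω * Z.rounding c t l (x j) j ω) ^ 2 ∂P ≤
      N * (r / (4 * c ^ 2)) := by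
  have hx' := fun j => hZ.measurable_of_sigmaOn (hx j)
  have hm : ∀ j, MemLp (fun ω => Z.contrib j t l ω * Z.rounding c t l (x j) j ω) 2 P := fun j =>
    hZ.memLp_contrib_mul j (hZ.memLp_rounding hc (hx' j) j)
  have h := integral_norm_sum_smul_sq_of_pairwise hm (fun i j hij => ?_) fun _ => 1
  · simp only [one_smul, one_pow, one_mul, Real.norm_eq_abs, sq_abs] at h
    rw [h]
    have hle : ∀ j, ∫ ω, (Z.contrib j t l ω * Z.rounding c t l (x j) j ω) ^ 2 ∂P ≤
        r / (4 * c ^ 2) := by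
      intro j
      have h1 := hZ.integral_mul_rounding_sq_le hc (T := {NoiseLabel.unif j t l}ᶜ)
        (Set.notMem_compl_iff.2 rfl)
        (measurable_compl_unif_of_drawn j (hx j)) (contrib_measurable_compl_unif j j)
        (hZ.integrable_contrib j) (Z.contrib_nonneg j t l)
      rw [hr j, one_div_mul_eq_div] at h1
      refine le_trans (le_of_eq ?_) h1
      refine integral_congr_ae (Filter.Eventually.of_forall fun ω => ?_)
      dsimp only
      rw [mul_pow, pow_two (Z.contrib j t l ω), contrib_mul_self]
      rfl
    simpa using Finset.sum_le_sum fun j (_ : j ∈ Finset.univ) => hle j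
  -- As i ≠ j, the rounding error of j does not involve the uniform variable of i, so it may be part
  -- of the weight W.
  · have h1 := hZ.integral_mul_rounding_compl hc (i := i) (hx i)
      (W := fun ω => Z.contrib i t l ω * (Z.contrib j t l ω * Z.rounding c t l (x j) j ω))
      ((contrib_measurable_compl_unif i i).mul ((contrib_measurable_compl_unif i j).mul
        (measurable_rounding_sigmaOn (by simpa using hij.symm)
          (measurable_compl_unif_of_drawn i (hx j)))))
      (hZ.integrable_contrib_mul i ((hm j).integrable (by norm_num)))
    rw [← h1]
    refine integral_congr_ae (Filter.Eventually.of_forall fun ω => ?_)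
    simp only [RCLike.inner_apply, conj_trivial]
    ring

/-- Rounding errors are orthogonal to the participation fluctuations. In the square of the latter,
participation is independent of the x_j, so its covariances factor out of the expectations. -/
theorem integral_aggregationNoise_sq_le (hZ : Z.HasJointLaw P 𝒟 θ a) (hc : 0 < c) {q : ℝ}
    (hr : ∀ j, ∫ ω, Z.contrib j t l ω ∂P = r)
    (hq : ∀ i j, i ≠ j → ∫ ω, Z.contrib i t l ω * Z.contrib j t l ω ∂P = q)
    (hx : ∀ j, Measurable[Z.sigmaOn (NoiseLabel.drawn N d t)] (x j))
    (hx2 : ∀ j, MemLp (x j) 2 P) :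
    ∫ ω, Z.aggregationNoise c r t l x ω ^ 2 ∂P ≤ N * (r / (4 * c ^ 2)) +
      ∑ i, ∑ j, ((if i = j then r else q) - r ^ 2) * ∫ ω, x i ω * x j ω ∂P := by
  have hx' := fun j => hZ.measurable_of_sigmaOn (hx j)
  have hR : ∀ j, MemLp (fun ω => Z.contrib j t l ω * Z.rounding c t l (x j) j ω) 2 P := fun j =>
    hZ.memLp_contrib_mul j (hZ.memLp_rounding hc (hx' j) j)
  have hS : ∀ j, MemLp (fun ω => (Z.contrib j t l ω - r) * x j ω) 2 P := fun j => by
    simp only [sub_mul]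
    exact (hZ.memLp_contrib_mul j (hx2 j)).sub ((hx2 j).const_mul r)
  have hRs := memLp_finsetSum Finset.univ fun j _ => hR j
  have hSs := memLp_finsetSum Finset.univ fun j _ => hS j
  have hcross : ∀ i j, ∫ ω, (Z.contrib i t l ω * Z.rounding c t l (x i) i ω) *
      ((Z.contrib j t l ω - r) * x j ω) ∂P = 0 := by
    intro i j
    rw [← hZ.integral_mul_rounding_compl hc (i := i) (hx i)
      (W := fun ω => Z.contrib i t l ω * ((Z.contrib j t l ω - r) * x j ω))
      ((contrib_measurable_compl_unif i i).mul (((contrib_measurable_compl_unif i j).sub_const r).mul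
        (measurable_compl_unif_of_drawn i (hx j))))
      (hZ.integrable_contrib_mul i ((hS j).integrable (by norm_num)))]
    exact integral_congr_ae (Filter.Eventually.of_forall fun ω => by dsimp only; ring)
  have hRS : ∫ ω, (∑ i, Z.contrib i t l ω * Z.rounding c t l (x i) i ω) *
      (∑ j, (Z.contrib j t l ω - r) * x j ω) ∂P = 0 := by
    have hi : ∀ i j, Integrable (fun ω => (Z.contrib i t l ω * Z.rounding c t l (x i) i ω) *
        ((Z.contrib j t l ω - r) * x j ω)) P := fun i j => (hR i).integrable_mul (hS j)
    simp_rw [Finset.sum_mul_sum]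
    rw [integral_finsetSum _ fun i _ => integrable_finsetSum _ fun j _ => hi i j]
    refine Finset.sum_eq_zero fun i _ => ?_
    rw [integral_finsetSum _ fun j _ => hi i j]
    exact Finset.sum_eq_zero fun j _ => hcross i j
  have hcov : ∀ i j, ∫ ω, (Z.contrib i t l ω - r) * (Z.contrib j t l ω - r) ∂P =
      (if i = j then r else q) - r ^ 2 := by
    intro i j
    have e : ∀ ω, (Z.contrib i t l ω - r) * (Z.contrib j t l ω - r) =
        Z.contrib i t l ω * Z.contrib j t l ω - r * Z.contrib i t l ω - r * Z.contrib j t l ω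
          + r ^ 2 := fun ω => by ring
    have hij : ∫ ω, Z.contrib i t l ω * Z.contrib j t l ω ∂P = if i = j then r else q := by
      split_ifs with h
      · subst h
        simp_rw [contrib_mul_self]
        exact hr i
      · exact hq i j h
    have i1 := hZ.integrable_contrib_mul (t := t) (l := l) i
      (hZ.integrable_contrib (t := t) (l := l) j)
    have i2 := fun k => (hZ.integrable_contrib (t := t) (l := l) k).const_mul r
    simp_rw [e]
    rw [integral_add ?_ (integrable_const _), integral_sub ?_ (i2 j), integral_sub i1 (i2 i),
      integral_const_mul, integral_const_mul, hr, hr, hij]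
    rotate_left
    · exact i1.sub (i2 i)
    · exact (i1.sub (i2 i)).sub (i2 j)
    · simp only [integral_const, probReal_univ, smul_eq_mul]
      ring
  have hSS : ∫ ω, (∑ j, (Z.contrib j t l ω - r) * x j ω) ^ 2 ∂P =
      ∑ i, ∑ j, ((if i = j then r else q) - r ^ 2) * ∫ ω, x i ω * x j ω ∂P := by
    have hi : ∀ i j, Integrable (fun ω => ((Z.contrib i t l ω - r) * x i ω) *
        ((Z.contrib j t l ω - r) * x j ω)) P := fun i j => (hS i).integrable_mul (hS j)
    simp_rw [pow_two (∑ j, _), Finset.sum_mul_sum]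
    rw [integral_finsetSum _ fun i _ => integrable_finsetSum _ fun j _ => hi i j]
    refine Finset.sum_congr rfl fun i _ => ?_
    rw [integral_finsetSum _ fun j _ => hi i j]
    refine Finset.sum_congr rfl fun j _ => ?_
    rw [← hcov, ← hZ.integral_mul_of_drawn_of_participation
      (A := fun ω => (Z.contrib i t l ω - r) * (Z.contrib j t l ω - r))
      (X := fun ω => x i ω * x j ω) (((Z.measurable_contrib_sigmaOn i t l).sub_const r).mul
        ((Z.measurable_contrib_sigmaOn j t l).sub_const r)) ((hx i).mul (hx j))]
    exact integral_congr_ae (Filter.Eventually.of_forall fun ω => by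
      dsimp only; ring)
  have e : ∀ ω, Z.aggregationNoise c r t l x ω ^ 2 =
      (∑ j, Z.contrib j t l ω * Z.rounding c t l (x j) j ω) ^ 2 +
      2 * ((∑ i, Z.contrib i t l ω * Z.rounding c t l (x i) i ω) *
      (∑ j, (Z.contrib j t l ω - r) * x j ω)) + (∑ j, (Z.contrib j t l ω - r) * x j ω) ^ 2 := by
    intro ω
    rw [aggregationNoise_eq]
    ring
  simp_rw [e]
  rw [integral_add ?_ hSs.integrable_sq, integral_add hRs.integrable_sq, integral_const_mul, hRS,
    hSS, mul_zero, add_zero]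
  · exact add_le_add_left (hZ.integral_rounding_sum_sq_le hc hr hx) _
  · exact (hRs.integrable_mul hSs).const_mul 2
  · exact hRs.integrable_sq.add ((hRs.integrable_mul hSs).const_mul 2)

end HasJointLaw

end FedNoise

/-! ### Pathwise description of the scheme and adaptedness -/

namespace FedScheme

variable {N d : ℕ} {Ξ Ω : Type*}

section Pathwise

/-- At a synchronization every user subtracts the same vector from its model E steps earlier, which
by induction was already common. -/
theorem localModel_eq_of_dvd (S : FedScheme N d Ξ) (Z : FedNoise N d Ξ Ω) (ω : Ω) {t : ℕ}
    (h : S.E ∣ t) (i j : Fin N) : S.localModel Z ω t i = S.localModel Z ω t j := by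
  induction t using Nat.strong_induction_on with
  | _ t ih =>
    cases t with
    | zero => rw [localModel_zero, localModel_zero]
    | succ t =>
      have hE : 0 < S.E := Nat.pos_of_dvd_of_pos h (Nat.succ_pos t)
      ext l
      rw [localModel_succ_sync S Z ω i h, localModel_succ_sync S Z ω j h,
        ih (t + 1 - S.E) (by omega) (Nat.dvd_sub h dvd_rfl)]

theorem localModel_eq_sub_sum (S : FedScheme N d Ξ) (Z : FedNoise N d Ξ Ω) (ω : Ω) (i : Fin N)
    {s t : ℕ} (hs : S.E ∣ s) (hst : s ≤ t) (ht : t < s + S.E) :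
    S.localModel Z ω t i = S.localModel Z ω s i - ∑ k ∈ Finset.Ico s t, S.z Z i k ω := by
  induction t, hst using Nat.le_induction with
  | base => simp
  | succ t hst ih =>
    -- Strictly between s and s + E there is no multiple of E, so only local steps occur.
    have hnd : ¬ S.E ∣ t + 1 := by
      intro h
      have h1 : S.E ∣ t + 1 - s := Nat.dvd_sub h hs
      have h2 := Nat.le_of_dvd (by omega) h1
      omega
    rw [localModel_succ_local S Z ω i hnd, ih (by omega), Finset.sum_Ico_succ_top hst]
    abel

theorem avgModel_eq_of_dvd (S : FedScheme N d Ξ) (Z : FedNoise N d Ξ Ω) (ω : Ω) {t : ℕ}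
    (hβ : ∑ i, S.β i = 1) (h : S.E ∣ t) (i : Fin N) :
    S.avgModel Z t ω = S.localModel Z ω t i := by
  rw [avgModel, Finset.sum_congr rfl fun j _ => by rw [S.localModel_eq_of_dvd Z ω h j i],
    ← Finset.sum_smul, hβ, one_smul]

/-- The average model after a local step of every user. -/
noncomputable def descentStep (S : FedScheme N d Ξ) (Z : FedNoise N d Ξ Ω) (t : ℕ) (ω : Ω) :
    Model d :=
  S.avgModel Z t ω - ∑ i, S.β i • S.z Z i t ω

/-- The values that user `j` quantizes at location `l` when `E ∣ t + 1`. -/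
noncomputable def upload (S : FedScheme N d Ξ) (Z : FedNoise N d Ξ Ω) (t : ℕ) (l : Fin d)
    (j : Fin N) (ω : Ω) : ℝ :=
  S.β j / S.p' * ∑ k ∈ Finset.Icc (t + 1 - S.E) t, S.z Z j k ω l

/-- The deviation of the synchronized average model from the average local step. -/
noncomputable def syncNoise (S : FedScheme N d Ξ) (Z : FedNoise N d Ξ Ω) (t : ℕ) (ω : Ω) :
    Model d :=
  WithLp.toLp 2 fun l => Z.aggregationNoise S.c S.p' t l (S.upload Z t l) ω

theorem avgModel_succ_local (S : FedScheme N d Ξ) (Z : FedNoise N d Ξ Ω) (ω : Ω) {t : ℕ}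
    (h : ¬ S.E ∣ t + 1) : S.avgModel Z (t + 1) ω = S.descentStep Z t ω := by
  simp only [avgModel, descentStep, S.localModel_succ_local Z ω _ h, smul_sub,
    Finset.sum_sub_distrib]

/-- Unrolling the round, the descent step is the common starting model minus ∑ β_j ∑ z_j, while
synchronization subtracts ∑ D_j M_j Q(x_j). Since p' x_j = β_j ∑ z_j, the difference is exactly the
centered aggregate. -/
theorem avgModel_succ_sync (S : FedScheme N d Ξ) (Z : FedNoise N d Ξ Ω) (ω : Ω) {t : ℕ}
    (hβ : ∑ i, S.β i = 1) (hp : S.p' ≠ 0) (h : S.E ∣ t + 1) :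
    S.avgModel Z (t + 1) ω = S.descentStep Z t ω - S.syncNoise Z t ω := by
  have hE : 0 < S.E := Nat.pos_of_dvd_of_pos h (Nat.succ_pos t)
  have hle : S.E ≤ t + 1 := Nat.le_of_dvd (Nat.succ_pos t) h
  have hs : S.E ∣ t + 1 - S.E := Nat.dvd_sub h dvd_rfl
  have hN : 0 < N := by
    rcases N.eq_zero_or_pos with rfl | hN
    · simp at hβ
    · exact hN
  let i : Fin N := ⟨0, hN⟩
  have hstep : S.descentStep Z t ω = S.localModel Z ω (t + 1 - S.E) i -
      ∑ j, S.β j • ∑ k ∈ Finset.Icc (t + 1 - S.E) t, S.z Z j k ω := by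
    have h1 : ∀ j, S.β j • S.localModel Z ω t j - S.β j • S.z Z j t ω =
        S.β j • S.localModel Z ω (t + 1 - S.E) i -
          S.β j • ∑ k ∈ Finset.Icc (t + 1 - S.E) t, S.z Z j k ω := by
      intro j
      rw [S.localModel_eq_sub_sum Z ω j hs (by omega : t + 1 - S.E ≤ t) (by omega),
        S.localModel_eq_of_dvd Z ω hs j i, ← Finset.Ico_add_one_right_eq_Icc,
        Finset.sum_Ico_succ_top (by omega), ← smul_sub, ← smul_sub]
      congr 1
      abel
    rw [descentStep, avgModel, ← Finset.sum_sub_distrib, Finset.sum_congr rfl fun j _ => h1 j,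
      Finset.sum_sub_distrib, ← Finset.sum_smul, hβ, one_smul]
  rw [S.avgModel_eq_of_dvd Z ω hβ h i, hstep]
  ext l
  have h2 : (∑ j, S.β j • ∑ k ∈ Finset.Icc (t + 1 - S.E) t, S.z Z j k ω) l =
      ∑ j, S.p' * S.upload Z t l j ω := by
    simp only [WithLp.ofLp_sum, WithLp.ofLp_smul, Finset.sum_apply, Pi.smul_apply, smul_eq_mul,
      upload]
    exact Finset.sum_congr rfl fun j _ => by field_simp
  rw [S.localModel_succ_sync Z ω i h, PiLp.sub_apply, PiLp.sub_apply, h2]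
  simp only [syncNoise, FedNoise.aggregationNoise, Finset.sum_sub_distrib, FedNoise.contrib, upload]
  ring

end Pathwise

section Measurability

variable [MeasurableSpace Ξ]

theorem measurable_stochGrad_of_localModel {S : FedScheme N d Ξ} (Z : FedNoise N d Ξ Ω) {i : Fin N}
    (hsg : Measurable (Function.uncurry (S.sg i))) {t : ℕ}
    (h : Measurable[Z.sigmaOn (NoiseLabel.past N d t)] fun ω => S.localModel Z ω t i) :
    Measurable[Z.sigmaOn (NoiseLabel.drawn N d t)] (S.stochGrad Z i t) := by
  have h1 : Measurable[Z.sigmaOn (NoiseLabel.drawn N d t)] fun ω => S.localModel Z ω t i :=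
    h.mono (Z.sigmaOn_mono NoiseLabel.past_subset_drawn) le_rfl
  exact hsg.comp (h1.prodMk (Z.measurable_sample_sigmaOn (Or.inr ⟨i, rfl⟩)))

theorem measurable_apply_sigma {m : MeasurableSpace Ω} {f : Ω → Model d} (hf : Measurable[m] f)
    (l : Fin d) : Measurable[m] fun ω => f ω l :=
  (PiLp.continuous_apply 2 _ l).measurable.comp hf

/-- Strong induction, because a synchronization looks back over the whole round. Adaptedness is what
makes every fresh variable independent of the current iterate. -/
theorem measurable_localModel {S : FedScheme N d Ξ} (Z : FedNoise N d Ξ Ω)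
    (hsg : ∀ i, Measurable (Function.uncurry (S.sg i))) (t : ℕ) (i : Fin N) :
    Measurable[Z.sigmaOn (NoiseLabel.past N d t)] fun ω => S.localModel Z ω t i := by
  induction t using Nat.strong_induction_on generalizing i with
  | _ t ih =>
    cases t with
    | zero => simp_rw [localModel_zero]; exact measurable_const
    | succ t =>
      have hz : ∀ k ≤ t, ∀ j,
          Measurable[Z.sigmaOn (NoiseLabel.past N d (t + 1))] (S.z Z j k) := fun k hk j =>
        ((measurable_stochGrad_of_localModel Z (hsg j) (ih k (by omega) j)).const_smul (S.η k)).mono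
          (Z.sigmaOn_mono (NoiseLabel.drawn_subset_past (by omega))) le_rfl
      have hw : ∀ k ≤ t, Measurable[Z.sigmaOn (NoiseLabel.past N d (t + 1))]
          fun ω => S.localModel Z ω k i := fun k hk =>
        (ih k (by omega) i).mono (Z.sigmaOn_mono (NoiseLabel.past_mono (by omega))) le_rfl
      by_cases h : S.E ∣ t + 1
      · have hE : 0 < S.E := Nat.pos_of_dvd_of_pos h (Nat.succ_pos t)
        have e : (fun ω => S.localModel Z ω (t + 1) i) = fun ω => WithLp.toLp 2 fun l =>
            S.localModel Z ω (t + 1 - S.E) i l - ∑ j, Z.contrib j t l ω *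
              quantize S.c (Z.unif j t l ω)
                (S.β j / S.p' * ∑ k ∈ Finset.Icc (t + 1 - S.E) t, S.z Z j k ω l) := by
          ext ω l
          exact S.localModel_succ_sync Z ω i h l
        rw [e]
        let _ := Z.sigmaOn (NoiseLabel.past N d (t + 1))
        refine (WithLp.measurable_toLp 2 _).comp (measurable_pi_lambda _ fun l => ?_)
        refine (measurable_apply_sigma (hw _ (by omega)) l).sub
          (Finset.measurable_fun_sum _ fun j _ => Measurable.mul ?_ ?_)
        · exact (Z.measurable_contrib_sigmaOn j t l).mono
            (Z.sigmaOn_mono (NoiseLabel.participation_subset_past (Nat.lt_succ_self t))) le_rfl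
        · have hu : Measurable (Z.unif j t l) := Z.measurable_unif_sigmaOn (Nat.lt_succ_self t)
          have hx : Measurable fun ω =>
              S.β j / S.p' * ∑ k ∈ Finset.Icc (t + 1 - S.E) t, S.z Z j k ω l :=
            Measurable.const_mul (Finset.measurable_fun_sum _ fun k hk =>
              measurable_apply_sigma (hz k (Finset.mem_Icc.1 hk).2 j) l) _
          exact measurable_quantize_comp S.c hu hx
      · simp_rw [S.localModel_succ_local Z _ i h]
        exact (hw t le_rfl).sub (hz t le_rfl i)

theorem measurable_stochGrad {S : FedScheme N d Ξ} (Z : FedNoise N d Ξ Ω)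
    (hsg : ∀ i, Measurable (Function.uncurry (S.sg i))) (t : ℕ) (i : Fin N) :
    Measurable[Z.sigmaOn (NoiseLabel.drawn N d t)] (S.stochGrad Z i t) :=
  measurable_stochGrad_of_localModel Z (hsg i) (measurable_localModel Z hsg t i)

theorem measurable_z {S : FedScheme N d Ξ} (Z : FedNoise N d Ξ Ω)
    (hsg : ∀ i, Measurable (Function.uncurry (S.sg i))) (t : ℕ) (i : Fin N) :
    Measurable[Z.sigmaOn (NoiseLabel.drawn N d t)] (S.z Z i t) :=
  (measurable_stochGrad Z hsg t i).const_smul (S.η t)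

theorem measurable_avgModel {S : FedScheme N d Ξ} (Z : FedNoise N d Ξ Ω)
    (hsg : ∀ i, Measurable (Function.uncurry (S.sg i))) (t : ℕ) :
    Measurable[Z.sigmaOn (NoiseLabel.past N d t)] (S.avgModel Z t) :=
  Finset.measurable_fun_sum _ fun i _ => (measurable_localModel Z hsg t i).const_smul (S.β i)

theorem measurable_descentStep {S : FedScheme N d Ξ} (Z : FedNoise N d Ξ Ω)
    (hsg : ∀ i, Measurable (Function.uncurry (S.sg i))) (t : ℕ) :
    Measurable[Z.sigmaOn (NoiseLabel.drawn N d t)] (S.descentStep Z t) :=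
  ((measurable_avgModel Z hsg t).mono (Z.sigmaOn_mono NoiseLabel.past_subset_drawn) le_rfl).sub
    (Finset.measurable_fun_sum _ fun i _ => (measurable_z Z hsg t i).const_smul (S.β i))

theorem measurable_upload {S : FedScheme N d Ξ} (Z : FedNoise N d Ξ Ω)
    (hsg : ∀ i, Measurable (Function.uncurry (S.sg i))) (t : ℕ) (l : Fin d) (j : Fin N) :
    Measurable[Z.sigmaOn (NoiseLabel.drawn N d t)] (S.upload Z t l j) := by
  refine Measurable.const_mul (Finset.measurable_fun_sum _ fun k hk => ?_) _
  refine measurable_apply_sigma ((measurable_z Z hsg k j).mono (Z.sigmaOn_mono ?_) le_rfl) l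
  rcases (Finset.mem_Icc.1 hk).2.eq_or_lt with rfl | h
  · exact subset_rfl
  · exact (NoiseLabel.drawn_subset_past h).trans NoiseLabel.past_subset_drawn

end Measurability

end FedScheme

theorem measurable_gradient {d : ℕ} (f : Model d → ℝ) : Measurable (gradient f) :=
  (InnerProductSpace.toDual ℝ (Model d)).symm.continuous.measurable.comp (measurable_fderiv ℝ f)

/-! ### Parameters of the scheme and the global objective -/

namespace FedScheme

variable {N d : ℕ} {Ξ Ω : Type*}

section Parameters

variable {S : FedScheme N d Ξ}

theorem pairProb_pos (hN : 2 ≤ N) (hα : 0 < S.α) : 0 < S.pairProb := by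
  have : (2 : ℝ) ≤ N := by exact_mod_cast hN
  exact div_pos hα (by linarith)

theorem pairProb_le_one (hN : 2 ≤ N) (hα : S.α ≤ (N : ℝ) - 1) : S.pairProb ≤ 1 := by
  have : (2 : ℝ) ≤ N := by exact_mod_cast hN
  exact (div_le_one (by linarith)).2 hα

theorem p'_pos (hθ : S.θ < 1) (hN : 2 ≤ N) (hα₀ : 0 < S.α) (hα₁ : S.α ≤ (N : ℝ) - 1) :
    0 < S.p' := by
  have h1 := pairProb_pos hN hα₀
  have h2 := pairProb_le_one hN hα₁
  have h3 : (1 - S.pairProb) ^ (N - 1) < 1 :=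
    pow_lt_one₀ (by linarith) (by linarith) (by omega)
  exact mul_pos (by linarith) (by rw [p]; linarith)

theorem p'_le_one (hθ₀ : 0 ≤ S.θ) (hθ : S.θ < 1) (hN : 2 ≤ N) (hα₁ : S.α ≤ (N : ℝ) - 1) :
    S.p' ≤ 1 := by
  have h2 := pairProb_le_one hN hα₁
  have h3 : 0 ≤ (1 - S.pairProb) ^ (N - 1) := pow_nonneg (by linarith) _
  rw [p', p]
  nlinarith

/-- With q the probability that a pair does not select, this reduces to q^(2N-2) ≤ q^(2N-3): the
shared bit makes participations positively correlated. -/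
theorem p'_sq_le_pTilde (hN : 2 ≤ N) (hα₀ : 0 < S.α) (hα₁ : S.α ≤ (N : ℝ) - 1) :
    S.p' ^ 2 ≤ S.pTilde := by
  have h1 := pairProb_pos hN hα₀
  have h2 := pairProb_le_one hN hα₁
  rw [p', mul_pow, pTilde, p]
  refine mul_le_mul_of_nonneg_left ?_ (sq_nonneg _)
  have h3 : ((1 - S.pairProb) ^ (N - 1)) ^ 2 ≤ (1 - S.pairProb) ^ (2 * N - 3) := by
    rw [← pow_mul]
    exact pow_le_pow_of_le_one (by linarith) (by linarith) (by omega)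
  nlinarith

end Parameters

section Objective

variable {S : FedScheme N d Ξ} {F : Fin N → Model d → ℝ} {L μ : ℝ}

theorem hasGradientAt_globalObj (hF : ∀ i, Differentiable ℝ (F i)) (w : Model d) :
    HasGradientAt (S.globalObj F) (∑ i, S.β i • gradient (F i) w) w := by
  rw [hasGradientAt_iff_hasFDerivAt, map_sum]
  have h : ∀ i ∈ Finset.univ, HasFDerivAt (fun v => S.β i * F i v)
      (InnerProductSpace.toDual ℝ (Model d) (S.β i • gradient (F i) w)) w := by
    intro i _
    rw [map_smul]
    exact (hF i w).hasGradientAt.hasFDerivAt.const_mul (S.β i)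
  exact HasFDerivAt.fun_sum h

theorem gradient_globalObj_eq_zero {s : Model d} (hs : IsMinOn (S.globalObj F) Set.univ s) :
    gradient (S.globalObj F) s = 0 := by
  rw [gradient, (hs.isLocalMin Filter.univ_mem).fderiv_eq_zero, map_zero]

theorem globalObj_smooth (hβ : ∀ i, 0 ≤ S.β i) (hsum : ∑ i, S.β i = 1)
    (hF : ∀ i, LSmooth L (F i)) : LSmooth L (S.globalObj F) := by
  have hd := fun i => (hF i).1
  refine ⟨fun w => (hasGradientAt_globalObj hd w).differentiableAt, fun v w => ?_⟩
  rw [(hasGradientAt_globalObj hd w).gradient, sum_inner]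
  have h := Finset.sum_le_sum fun i (_ : i ∈ Finset.univ) =>
    mul_le_mul_of_nonneg_left ((hF i).2 v w) (hβ i)
  simp only [mul_add, Finset.sum_add_distrib, ← Finset.sum_mul, hsum, one_mul] at h
  simpa only [globalObj, inner_smul_left, conj_trivial] using h

theorem globalObj_strongConvexOn (hβ : ∀ i, 0 ≤ S.β i) (hsum : ∑ i, S.β i = 1)
    (hF : ∀ i, StrongConvexOn Set.univ μ (F i)) : StrongConvexOn Set.univ μ (S.globalObj F) := by
  refine ⟨convex_univ, fun x hx y hy a b ha hb hab => ?_⟩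
  have h := Finset.sum_le_sum fun i (_ : i ∈ Finset.univ) =>
    mul_le_mul_of_nonneg_left ((hF i).2 hx hy ha hb hab) (hβ i)
  refine h.trans (le_of_eq ?_)
  simp only [smul_eq_mul, mul_sub, mul_add, Finset.sum_add_distrib, Finset.sum_sub_distrib,
    ← Finset.sum_mul, hsum, one_mul, globalObj, Finset.mul_sum]
  congr 1
  congr 1 <;> exact Finset.sum_congr rfl fun i _ => by ring

theorem iInf_eq_of_isMinOn_univ {V : Type*} {f : V → ℝ} {s : V} (h : IsMinOn f Set.univ s) :
    ⨅ v, f v = f s := by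
  have : Nonempty V := ⟨s⟩
  have hle : ∀ v, f s ≤ f v := fun v => h (Set.mem_univ v)
  exact le_antisymm (ciInf_le ⟨f s, by rintro _ ⟨v, rfl⟩; exact hle v⟩ s) (le_ciInf hle)

end Objective

/-- The standing assumptions on a run of the scheme up to time `J`. -/
structure IsRun [MeasurableSpace Ξ] [MeasurableSpace Ω] (S : FedScheme N d Ξ)
    (Z : FedNoise N d Ξ Ω) (P : Measure Ω) (𝒟 : Fin N → Measure Ξ) (F : Fin N → Model d → ℝ)
    (L μ : ℝ) (J : ℕ) (σ : Fin N → ℝ) (G : ℝ) : Prop where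
  β_nonneg : ∀ i, 0 ≤ S.β i
  β_sum : ∑ i, S.β i = 1
  θ_nonneg : 0 ≤ S.θ
  θ_lt_one : S.θ < 1
  two_le : 2 ≤ N
  α_pos : 0 < S.α
  α_le : S.α ≤ (N : ℝ) - 1
  c_pos : 0 < S.c
  E_pos : 1 ≤ S.E
  law : Z.HasJointLaw P 𝒟 S.θ S.pairProb
  μ_pos : 0 < μ
  L_pos : 0 < L
  smooth : ∀ i, LSmooth L (F i)
  convex : ∀ i, StrongConvexOn Set.univ μ (F i)
  measurable_sg : ∀ i, Measurable (Function.uncurry (S.sg i))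
  unbiased : ∀ i w, Integrable (S.sg i w) (𝒟 i) ∧ ∫ x, S.sg i w x ∂(𝒟 i) = gradient (F i) w
  variance : ∀ i, ∀ t < J,
    Integrable (fun ω => ‖S.stochGrad Z i t ω - gradient (F i) (S.localModel Z ω t i)‖ ^ 2) P ∧
    ∫ ω, ‖S.stochGrad Z i t ω - gradient (F i) (S.localModel Z ω t i)‖ ^ 2 ∂P ≤ σ i ^ 2
  moment : ∀ i, ∀ t < J, Integrable (fun ω => ‖S.stochGrad Z i t ω‖ ^ 2) P ∧
    ∫ ω, ‖S.stochGrad Z i t ω‖ ^ 2 ∂P ≤ G ^ 2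
  η_pos : ∀ t, 0 < S.η t
  η_anti : Antitone S.η
  η_le : ∀ t, S.η t ≤ 2 * S.η (t + S.E)
  η_small : ∀ t, 4 * L * S.η t ≤ 1

/-! ### One-step estimates along a run -/

namespace IsRun

variable [MeasurableSpace Ξ] [MeasurableSpace Ω] {S : FedScheme N d Ξ} {Z : FedNoise N d Ξ Ω}
  {P : Measure Ω} {𝒟 : Fin N → Measure Ξ} {F : Fin N → Model d → ℝ} {L μ : ℝ} {J : ℕ}
  {σ : Fin N → ℝ} {G : ℝ}

theorem p'_pos (H : S.IsRun Z P 𝒟 F L μ J σ G) : 0 < S.p' :=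
  FedScheme.p'_pos H.θ_lt_one H.two_le H.α_pos H.α_le

theorem η_le_two_mul (H : S.IsRun Z P 𝒟 F L μ J σ G) {s t : ℕ} (h : t ≤ s + S.E) :
    S.η s ≤ 2 * S.η t :=
  (H.η_le s).trans (mul_le_mul_of_nonneg_left (H.η_anti h) zero_le_two)

/-- The covariance of the participations of users `i` and `j`. -/
noncomputable def _root_.FedScheme.cov (S : FedScheme N d Ξ) (i j : Fin N) : ℝ :=
  (if i = j then S.p' else S.pTilde) - S.p' ^ 2

/-- Nonnegativity allows each inner product multiplied by a covariance to be replaced by an upper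
bound. -/
theorem cov_nonneg (H : S.IsRun Z P 𝒟 F L μ J σ G) (i j : Fin N) : 0 ≤ S.cov i j := by
  unfold cov
  split_ifs
  · nlinarith [H.p'_pos, p'_le_one H.θ_nonneg H.θ_lt_one H.two_le H.α_le]
  · linarith [p'_sq_le_pTilde (S := S) H.two_le H.α_pos H.α_le]

theorem sum_cov (H : S.IsRun Z P 𝒟 F L μ J σ G) :
    ∑ i, ∑ j, S.cov i j * (S.β i / S.p' * (S.β j / S.p')) =
      ∑ i, (S.β i ^ 2 * (1 / S.p' - 1) +
        ∑ j ∈ Finset.univ.erase i, S.β i * S.β j * (S.pTilde / S.p' ^ 2 - 1)) := by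
  have hp := H.p'_pos.ne'
  refine Finset.sum_congr rfl fun i _ => ?_
  rw [← Finset.add_sum_erase _ _ (Finset.mem_univ i)]
  congr 1
  · rw [cov, if_pos rfl]
    field_simp
  · refine Finset.sum_congr rfl fun j hj => ?_
    rw [cov, if_neg (Finset.ne_of_mem_erase hj).symm]
    field_simp

theorem constC_nonneg (H : S.IsRun Z P 𝒟 F L μ J σ G) : 0 ≤ S.constC G J := by
  have hp := H.p'_pos
  rw [constC, ← H.sum_cov]
  refine add_nonneg (by positivity) (mul_nonneg (by positivity) ?_)
  exact Finset.sum_nonneg fun i _ => Finset.sum_nonneg fun j _ => mul_nonneg (H.cov_nonneg i j)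
    (mul_nonneg (div_nonneg (H.β_nonneg i) hp.le) (div_nonneg (H.β_nonneg j) hp.le))

theorem heterogeneity_nonneg (H : S.IsRun Z P 𝒟 F L μ J σ G) : 0 ≤ S.heterogeneity F := by
  have h : ∀ w, ∑ i, S.β i * (⨅ v, F i v) ≤ S.globalObj F w := fun w =>
    Finset.sum_le_sum fun i _ => mul_le_mul_of_nonneg_left
      (ciInf_le ((H.convex i).bddBelow_range H.μ_pos (H.smooth i).1) w) (H.β_nonneg i)
  exact sub_nonneg.2 (le_ciInf h)

theorem le_constB (H : S.IsRun Z P 𝒟 F L μ J σ G) :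
    8 * ((S.E : ℝ) - 1) ^ 2 * G ^ 2 ≤ S.constB F L G σ := by
  have h1 := mul_nonneg (by linarith [H.L_pos] : 0 ≤ 6 * L) H.heterogeneity_nonneg
  have h2 : 0 ≤ ∑ i, S.β i ^ 2 * σ i ^ 2 := Finset.sum_nonneg fun i _ => by positivity
  rw [constB]
  linarith

/-- The error of the stochastic gradient of user `i` at time `t`. -/
noncomputable def _root_.FedScheme.gradError (S : FedScheme N d Ξ) (Z : FedNoise N d Ξ Ω)
    (F : Fin N → Model d → ℝ) (t : ℕ) (i : Fin N) (ω : Ω) : Model d :=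
  S.stochGrad Z i t ω - gradient (F i) (S.localModel Z ω t i)

theorem measurable_gradError (H : S.IsRun Z P 𝒟 F L μ J σ G) (t : ℕ) (i : Fin N)
    {T : Set (NoiseLabel N d)} (hT : NoiseLabel.past N d t ⊆ T) (hi : .sample i t ∈ T) :
    Measurable[Z.sigmaOn T] (S.gradError Z F t i) := by
  have h : Measurable[Z.sigmaOn T] fun ω => S.localModel Z ω t i :=
    (measurable_localModel Z H.measurable_sg t i).mono (Z.sigmaOn_mono hT) le_rfl
  exact ((H.measurable_sg i).comp (h.prodMk (Z.measurable_sample_sigmaOn hi))).sub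
    ((measurable_gradient (F i)).comp h)

theorem memLp_gradError (H : S.IsRun Z P 𝒟 F L μ J σ G) {t : ℕ} (ht : t < J) (i : Fin N) :
    MemLp (S.gradError Z F t i) 2 P :=
  (memLp_two_iff_integrable_sq_norm (H.law.measurable_of_sigmaOn (H.measurable_gradError t i
    NoiseLabel.past_subset_drawn (Or.inr ⟨i, rfl⟩))).aestronglyMeasurable).2 (H.variance i t ht).1

theorem memLp_stochGrad (H : S.IsRun Z P 𝒟 F L μ J σ G) {t : ℕ} (ht : t < J) (i : Fin N) :
    MemLp (S.stochGrad Z i t) 2 P :=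
  (memLp_two_iff_integrable_sq_norm (H.law.measurable_of_sigmaOn
    (measurable_stochGrad Z H.measurable_sg t i)).aestronglyMeasurable).2 (H.moment i t ht).1

theorem memLp_z (H : S.IsRun Z P 𝒟 F L μ J σ G) {t : ℕ} (ht : t < J) (i : Fin N) :
    MemLp (S.z Z i t) 2 P :=
  (H.memLp_stochGrad ht i).const_smul (S.η t)

theorem integral_norm_z_sq_le (H : S.IsRun Z P 𝒟 F L μ J σ G) {t : ℕ} (ht : t < J) (i : Fin N)
    {b : ℝ} (hb : S.η t ≤ b) : ∫ ω, ‖S.z Z i t ω‖ ^ 2 ∂P ≤ b ^ 2 * G ^ 2 := by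
  simp only [z, norm_smul, mul_pow, Real.norm_of_nonneg (H.η_pos t).le]
  rw [integral_const_mul]
  exact mul_le_mul (pow_le_pow_left₀ (H.η_pos t).le hb 2) (H.moment i t ht).2
    (integral_nonneg fun _ => sq_nonneg _) (sq_nonneg _)

theorem memLp_upload (H : S.IsRun Z P 𝒟 F L μ J σ G) {t : ℕ} (ht : t < J) (l : Fin d)
    (j : Fin N) : MemLp (S.upload Z t l j) 2 P := by
  have h : MemLp (fun ω => ∑ k ∈ Finset.Icc (t + 1 - S.E) t, S.z Z j k ω l) 2 P :=
    memLp_finsetSum _ fun k hk =>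
      (H.memLp_z (lt_of_le_of_lt (Finset.mem_Icc.1 hk).2 ht) j).eval_piLp l
  exact h.const_mul _

variable [IsProbabilityMeasure P]

theorem memLp_syncNoise (H : S.IsRun Z P 𝒟 F L μ J σ G) {t : ℕ} (ht : t < J) :
    MemLp (S.syncNoise Z t) 2 P :=
  MemLp.of_eval_piLp fun l => H.law.memLp_aggregationNoise H.c_pos
    (fun j => H.law.measurable_of_sigmaOn (measurable_upload Z H.measurable_sg t l j))
    (H.memLp_upload ht l)

theorem memLp_localModel (H : S.IsRun Z P 𝒟 F L μ J σ G) {t : ℕ} (ht : t ≤ J) (i : Fin N) :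
    MemLp (fun ω => S.localModel Z ω t i) 2 P := by
  induction t generalizing i with
  | zero => simp_rw [localModel_zero]; exact memLp_const _
  | succ t ih =>
    have ih := ih (by omega)
    by_cases h : S.E ∣ t + 1
    -- At a synchronization the local model equals the average, so the pathwise formula writes it as
    -- square-integrable terms.
    · simp_rw [← S.avgModel_eq_of_dvd Z _ H.β_sum h i,
        S.avgModel_succ_sync Z _ H.β_sum H.p'_pos.ne' h]
      refine MemLp.sub (MemLp.sub ?_ ?_) (H.memLp_syncNoise ht)
      · exact memLp_finsetSum _ fun j _ => (ih j).const_smul (S.β j)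
      · exact memLp_finsetSum _ fun j _ => (H.memLp_z ht j).const_smul (S.β j)
    · simp_rw [S.localModel_succ_local Z _ i h]
      exact (ih i).sub (H.memLp_z ht i)

theorem memLp_avgModel (H : S.IsRun Z P 𝒟 F L μ J σ G) {t : ℕ} (ht : t ≤ J) :
    MemLp (S.avgModel Z t) 2 P :=
  memLp_finsetSum _ fun j _ => (H.memLp_localModel ht j).const_smul (S.β j)

theorem memLp_descentStep (H : S.IsRun Z P 𝒟 F L μ J σ G) {t : ℕ} (ht : t < J) :
    MemLp (S.descentStep Z t) 2 P :=
  (H.memLp_avgModel ht.le).sub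
    (memLp_finsetSum _ fun j _ => (H.memLp_z ht j).const_smul (S.β j))

theorem integral_inner_gradError (H : S.IsRun Z P 𝒟 F L μ J σ G) {t : ℕ} (ht : t < J)
    (i : Fin N) {T : Set (NoiseLabel N d)} (hT : NoiseLabel.past N d t ⊆ T)
    (hi : .sample i t ∉ T) {V : Ω → Model d} (hV : Measurable[Z.sigmaOn T] V)
    (hV2 : MemLp V 2 P) : ∫ ω, inner ℝ (V ω) (S.gradError Z F t i ω) ∂P = 0 :=
  H.law.integral_inner_sub_gradient (H.measurable_sg i) (measurable_gradient (F i)) (H.unbiased i)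
    hi ((measurable_localModel Z H.measurable_sg t i).mono (Z.sigmaOn_mono hT) le_rfl) hV
    (hV2.integrable_real_inner (H.memLp_gradError ht i))

theorem sample_notMem_past (t : ℕ) (i : Fin N) : NoiseLabel.sample i t ∉ NoiseLabel.past N d t :=
  fun h => lt_irrefl t h

/-- Enlarge the past by the sample of user i: the error of i becomes a frozen direction, while the
sample of j is still fresh. -/
theorem integral_inner_gradError_gradError (H : S.IsRun Z P 𝒟 F L μ J σ G) {t : ℕ} (ht : t < J)
    {i j : Fin N} (hij : i ≠ j) :
    ∫ ω, inner ℝ (S.gradError Z F t i ω) (S.gradError Z F t j ω) ∂P = 0 := by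
  refine H.integral_inner_gradError ht j (T := insert (.sample i t) (NoiseLabel.past N d t))
    (Set.subset_insert _ _) ?_ (H.measurable_gradError t i (Set.subset_insert _ _)
      (Set.mem_insert _ _)) (H.memLp_gradError ht i)
  rintro (h | h)
  · exact hij (NoiseLabel.sample.inj h).1.symm
  · exact sample_notMem_past t j h

/-- At time 0 the iterate is deterministic, so the second moment is the squared gradient norm plus a
variance. -/
theorem norm_gradient_sq_le_moment (H : S.IsRun Z P 𝒟 F L μ J σ G) (hJ : 0 < J) (i : Fin N) :
    ‖gradient (F i) S.w₀‖ ^ 2 ≤ G ^ 2 := by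
  have h0 := H.integral_inner_gradError hJ i subset_rfl (sample_notMem_past 0 i)
    (V := fun _ => gradient (F i) S.w₀) measurable_const (memLp_const _)
  have h1 := integral_norm_sub_sq_of_integral_inner_eq_zero (P := P)
    (f := fun _ => gradient (F i) S.w₀) (g := fun ω => -S.gradError Z F 0 i ω) (memLp_const _)
    (H.memLp_gradError hJ i).neg (by simp_rw [inner_neg_right]; rw [integral_neg, h0, neg_zero])
  have h2 := (H.moment i 0 hJ).2
  have h3 : ∀ ω, gradient (F i) S.w₀ - -S.gradError Z F 0 i ω = S.stochGrad Z i 0 ω := by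
    intro ω
    rw [gradError, localModel_zero]
    abel
  simp_rw [h3] at h1
  rw [h1] at h2
  have h4 : 0 ≤ ∫ ω, ‖-S.gradError Z F 0 i ω‖ ^ 2 ∂P := integral_nonneg fun _ => sq_nonneg _
  simp only [integral_const, probReal_univ, one_smul] at h2
  linarith

/-- At the last multiple of E up to t all models coincide. Since then there were at most E - 1
steps, each with rate at most 2η_t; squaring gives the constant 4(E - 1)². -/
theorem integral_dispersion_le (H : S.IsRun Z P 𝒟 F L μ J σ G) {t : ℕ} (ht : t < J) :
    ∫ ω, ∑ i, S.β i * ‖S.avgModel Z t ω - S.localModel Z ω t i‖ ^ 2 ∂P ≤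
      4 * ((S.E : ℝ) - 1) ^ 2 * S.η t ^ 2 * G ^ 2 := by
  set s := S.E * (t / S.E) with hs
  have hsd : S.E ∣ s := dvd_mul_right _ _
  have hst : s ≤ t := Nat.mul_div_le t S.E
  have hmod : t - s < S.E := by
    have h1 := Nat.div_add_mod t S.E
    have h2 := Nat.mod_lt t (lt_of_lt_of_le one_pos H.E_pos)
    omega
  have hz : ∀ i, ∀ k ∈ Finset.Ico s t, MemLp (S.z Z i k) 2 P := fun i k hk =>
    H.memLp_z ((Finset.mem_Ico.1 hk).2.trans ht) i
  have hsq : ∀ i, Integrable (fun ω => ‖∑ k ∈ Finset.Ico s t, S.z Z i k ω‖ ^ 2) P := fun i =>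
    (memLp_finsetSum _ (hz i)).integrable_norm_sq
  have hle : ∀ ω, ∑ i, S.β i * ‖S.avgModel Z t ω - S.localModel Z ω t i‖ ^ 2 ≤
      ∑ i, S.β i * ‖∑ k ∈ Finset.Ico s t, S.z Z i k ω‖ ^ 2 := by
    intro ω
    refine (sum_mul_norm_sub_mean_sq_le H.β_sum (fun i => S.localModel Z ω t i)
      (S.avgModel Z s ω)).trans (le_of_eq (Finset.sum_congr rfl fun i _ => ?_))
    rw [S.localModel_eq_sub_sum Z ω i hsd hst (by omega), S.avgModel_eq_of_dvd Z ω H.β_sum hsd i,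
      ← norm_neg]
    congr 3
    abel
  have hb : ∀ i, ∫ ω, ‖∑ k ∈ Finset.Ico s t, S.z Z i k ω‖ ^ 2 ∂P ≤
      4 * ((S.E : ℝ) - 1) ^ 2 * S.η t ^ 2 * G ^ 2 := by
    intro i
    refine (integral_norm_sum_sq_le _ (hz i) (b := (2 * S.η t) ^ 2 * G ^ 2) fun k hk => ?_).trans ?_
    · have hk := Finset.mem_Ico.1 hk
      exact H.integral_norm_z_sq_le (hk.2.trans ht) i (H.η_le_two_mul (by omega))
    · rw [Nat.card_Ico]
      have h1 : ((t - s : ℕ) : ℝ) ≤ (S.E : ℝ) - 1 := by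
        rw [le_sub_iff_add_le]
        exact_mod_cast hmod
      have h2 := pow_le_pow_left₀ (Nat.cast_nonneg (t - s)) h1 2
      have h3 := mul_le_mul_of_nonneg_right h2
        (by positivity : 0 ≤ (2 * S.η t) ^ 2 * G ^ 2)
      linarith
  calc ∫ ω, ∑ i, S.β i * ‖S.avgModel Z t ω - S.localModel Z ω t i‖ ^ 2 ∂P
      ≤ ∫ ω, ∑ i, S.β i * ‖∑ k ∈ Finset.Ico s t, S.z Z i k ω‖ ^ 2 ∂P :=
        integral_mono (integrable_finsetSum _ fun i _ => ((H.memLp_avgModel ht.le).sub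
          (H.memLp_localModel ht.le i)).integrable_norm_sq.const_mul _)
          (integrable_finsetSum _ fun i _ => (hsq i).const_mul _) hle
    _ = ∑ i, S.β i * ∫ ω, ‖∑ k ∈ Finset.Ico s t, S.z Z i k ω‖ ^ 2 ∂P := by
        rw [integral_finsetSum _ fun i _ => (hsq i).const_mul _]
        exact Finset.sum_congr rfl fun i _ => integral_const_mul _ _
    _ ≤ ∑ i, S.β i * (4 * ((S.E : ℝ) - 1) ^ 2 * S.η t ^ 2 * G ^ 2) :=
        Finset.sum_le_sum fun i _ => mul_le_mul_of_nonneg_left (hb i) (H.β_nonneg i)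
    _ = _ := by rw [← Finset.sum_mul, H.β_sum, one_mul]

/-- The step splits as U - R into a past-measurable true-gradient step and the centered gradient
errors. The dispersion constant 4, doubled by the deterministic inequality, becomes the 8 in B. -/
theorem integral_norm_descentStep_sub_sq_le (H : S.IsRun Z P 𝒟 F L μ J σ G) {t : ℕ} (ht : t < J)
    {s : Model d} (hs : IsMinOn (S.globalObj F) Set.univ s) :
    ∫ ω, ‖S.descentStep Z t ω - s‖ ^ 2 ∂P ≤
      (1 - μ * S.η t) * ∫ ω, ‖S.avgModel Z t ω - s‖ ^ 2 ∂P +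
        S.η t ^ 2 * S.constB F L G σ := by
  let U : Ω → Model d := fun ω => S.avgModel Z t ω -
    S.η t • (∑ i, S.β i • gradient (F i) (S.localModel Z ω t i)) - s
  let R : Ω → Model d := fun ω => ∑ i, (S.η t * S.β i) • S.gradError Z F t i ω
  have hgrad : ∀ i, MemLp (fun ω => gradient (F i) (S.localModel Z ω t i)) 2 P := by
    intro i
    have h := (H.memLp_stochGrad ht i).sub (H.memLp_gradError ht i)
    refine h.ae_eq (Filter.Eventually.of_forall fun ω => ?_)
    simp [gradError]
  have hU2 : MemLp U 2 P := ((H.memLp_avgModel ht.le).sub ((memLp_finsetSum _ fun i _ =>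
    (hgrad i).const_smul (S.β i)).const_smul (S.η t))).sub (memLp_const s)
  have hR2 : MemLp R 2 P :=
    memLp_finsetSum _ fun i _ => (H.memLp_gradError ht i).const_smul (S.η t * S.β i)
  have hUm : Measurable[Z.sigmaOn (NoiseLabel.past N d t)] U :=
    ((measurable_avgModel Z H.measurable_sg t).sub ((Finset.measurable_fun_sum _ fun i _ =>
      ((measurable_gradient (F i)).comp
        (measurable_localModel Z H.measurable_sg t i)).const_smul (S.β i)).const_smul
        (S.η t))).sub_const s
  have hUR : ∫ ω, inner ℝ (U ω) (R ω) ∂P = 0 := by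
    simp only [R, inner_sum, inner_smul_right]
    rw [integral_finsetSum _ fun i _ =>
      (hU2.integrable_real_inner (H.memLp_gradError ht i)).const_mul _]
    refine Finset.sum_eq_zero fun i _ => ?_
    rw [integral_const_mul, H.integral_inner_gradError ht i subset_rfl (sample_notMem_past t i) hUm
      hU2, mul_zero]
  have hdec : ∀ ω, S.descentStep Z t ω - s = U ω - R ω := by
    intro ω
    simp only [U, R, descentStep, z, gradError, smul_sub, mul_smul, Finset.sum_sub_distrib,
      Finset.smul_sum, smul_comm (S.η t)]
    abel
  have hRsq : ∫ ω, ‖R ω‖ ^ 2 ∂P ≤ S.η t ^ 2 * ∑ i, S.β i ^ 2 * σ i ^ 2 := by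
    rw [integral_norm_sum_smul_sq_of_pairwise (H.memLp_gradError ht)
      (fun i j hij => H.integral_inner_gradError_gradError ht hij), Finset.mul_sum]
    refine Finset.sum_le_sum fun i _ => ?_
    rw [mul_pow, mul_assoc]
    exact mul_le_mul_of_nonneg_left (mul_le_mul_of_nonneg_left (H.variance i t ht).2
      (sq_nonneg _)) (sq_nonneg _)
  have hdisp : Integrable
      (fun ω => ∑ i, S.β i * ‖S.avgModel Z t ω - S.localModel Z ω t i‖ ^ 2) P :=
    integrable_finsetSum _ fun i _ => ((H.memLp_avgModel ht.le).sub
      (H.memLp_localModel ht.le i)).integrable_norm_sq.const_mul _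
  have havg : Integrable (fun ω => ‖S.avgModel Z t ω - s‖ ^ 2) P :=
    ((H.memLp_avgModel ht.le).sub (memLp_const s)).integrable_norm_sq
  have hΓ : S.heterogeneity F = ∑ i, S.β i * F i s - ∑ i, S.β i * ⨅ v, F i v := by
    rw [heterogeneity, iInf_eq_of_isMinOn_univ hs]
    rfl
  have hUsq : ∫ ω, ‖U ω‖ ^ 2 ∂P ≤ (1 - μ * S.η t) * ∫ ω, ‖S.avgModel Z t ω - s‖ ^ 2 ∂P +
      6 * L * S.η t ^ 2 * S.heterogeneity F +
      2 * ∫ ω, ∑ i, S.β i * ‖S.avgModel Z t ω - S.localModel Z ω t i‖ ^ 2 ∂P := by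
    have h1 := integral_mono (μ := P) hU2.integrable_norm_sq
      (((havg.const_mul (1 - μ * S.η t)).add (integrable_const
        (6 * L * S.η t ^ 2 * S.heterogeneity F))).add (hdisp.const_mul 2)) fun ω => by
      have := norm_averaged_gradient_step_sq_le H.β_nonneg H.β_sum H.L_pos H.μ_pos
        (fun i => (H.smooth i).1) (fun i => (H.smooth i).2) H.convex (H.η_pos t) (H.η_small t) s
        (fun v => hs (Set.mem_univ v)) fun i => S.localModel Z ω t i
      rw [← hΓ] at this
      exact this
    refine h1.trans (le_of_eq ?_)
    rw [integral_add' ?_ (hdisp.const_mul 2), integral_add' (havg.const_mul _) (integrable_const _),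
      integral_const_mul, integral_const_mul, integral_const, probReal_univ, one_smul,
      integral_const_mul]
    exact (havg.const_mul _).add (integrable_const _)
  have hd := H.integral_dispersion_le ht
  simp_rw [hdec]
  rw [integral_norm_sub_sq_of_integral_inner_eq_zero hU2 hR2 hUR, constB]
  linarith

theorem integral_norm_syncNoise_sq_le (H : S.IsRun Z P 𝒟 F L μ J σ G) {t : ℕ} (ht : t < J)
    (hdvd : S.E ∣ t + 1) :
    ∫ ω, ‖S.syncNoise Z t ω‖ ^ 2 ∂P ≤ S.η t ^ 2 * S.constC G J := by
  have hp := H.p'_pos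
  have hle : S.E ≤ t + 1 := Nat.le_of_dvd (Nat.succ_pos t) hdvd
  have ha := (pairProb_pos H.two_le H.α_pos).le
  let X : Fin N → Ω → Model d := fun j ω => ∑ k ∈ Finset.Icc (t + 1 - S.E) t, S.z Z j k ω
  have hz : ∀ j, ∀ k ∈ Finset.Icc (t + 1 - S.E) t, MemLp (S.z Z j k) 2 P := fun j k hk =>
    H.memLp_z (lt_of_le_of_lt (Finset.mem_Icc.1 hk).2 ht) j
  have hX2 : ∀ j, MemLp (X j) 2 P := fun j => memLp_finsetSum _ (hz j)
  have hXb : ∀ j, ∫ ω, ‖X j ω‖ ^ 2 ∂P ≤ (S.E : ℝ) ^ 2 * ((2 * S.η t) ^ 2 * G ^ 2) := by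
    intro j
    have hcard : (Finset.Icc (t + 1 - S.E) t).card = S.E := by rw [Nat.card_Icc]; omega
    have h := integral_norm_sum_sq_le _ (hz j) (b := (2 * S.η t) ^ 2 * G ^ 2) fun k hk => by
      have hk := Finset.mem_Icc.1 hk
      exact H.integral_norm_z_sq_le (lt_of_le_of_lt hk.2 ht) j (H.η_le_two_mul (by omega))
    rwa [hcard] at h
  have hup : ∀ i j ω, ∑ l, S.upload Z t l i ω * S.upload Z t l j ω =
      S.β i / S.p' * (S.β j / S.p') * inner ℝ (X i ω) (X j ω) := by
    intro i j ω
    simp only [X, PiLp.inner_apply, Finset.mul_sum, upload, RCLike.inner_apply, conj_trivial,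
      WithLp.ofLp_sum, Finset.sum_apply]
    refine Finset.sum_congr rfl fun l _ => ?_
    simp only [← Finset.mul_sum]
    ring
  have hcoord : ∀ l, ∫ ω, S.syncNoise Z t ω l ^ 2 ∂P ≤ N * (S.p' / (4 * S.c ^ 2)) +
      ∑ i, ∑ j, S.cov i j * ∫ ω, S.upload Z t l i ω * S.upload Z t l j ω ∂P := fun l =>
    H.law.integral_aggregationNoise_sq_le H.c_pos
      (fun j => H.law.integral_contrib H.θ_nonneg ha j t l)
      (fun i j hij => H.law.integral_contrib_mul_contrib H.θ_nonneg ha hij t l)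
      (measurable_upload Z H.measurable_sg t l) (H.memLp_upload ht l)
  have hsum : ∑ l, ∑ i, ∑ j, S.cov i j * ∫ ω, S.upload Z t l i ω * S.upload Z t l j ω ∂P ≤
      (S.E : ℝ) ^ 2 * ((2 * S.η t) ^ 2 * G ^ 2) *
        ∑ i, ∑ j, S.cov i j * (S.β i / S.p' * (S.β j / S.p')) := by
    rw [Finset.sum_comm, Finset.mul_sum]
    refine Finset.sum_le_sum fun i _ => ?_
    rw [Finset.sum_comm, Finset.mul_sum]
    refine Finset.sum_le_sum fun j _ => ?_
    have hint : ∀ l, Integrable (fun ω => S.upload Z t l i ω * S.upload Z t l j ω) P :=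
      fun l => (H.memLp_upload ht l i).integrable_mul (H.memLp_upload ht l j)
    -- The covariances do not depend on the location, so summing over l turns products of
    -- coordinates into inner products of the accumulated steps.
    rw [← Finset.mul_sum, ← integral_finsetSum _ fun l _ => hint l]
    simp_rw [hup]
    rw [integral_const_mul, mul_left_comm ((S.E : ℝ) ^ 2 * _)]
    refine mul_le_mul_of_nonneg_left ?_ (H.cov_nonneg i j)
    rw [mul_comm _ (S.β i / S.p' * (S.β j / S.p'))]
    exact mul_le_mul_of_nonneg_left
      (integral_inner_le_of_integral_norm_sq_le (hX2 i) (hX2 j) (hXb i) (hXb j))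
      (mul_nonneg (div_nonneg (H.β_nonneg i) hp.le) (div_nonneg (H.β_nonneg j) hp.le))
  -- The rounding variance does not scale with η_t². Dividing by η_{J-1}² in C compensates, as η_t ≥
  -- η_{J-1} for t < J.
  have hquant : (d : ℝ) * (N * (S.p' / (4 * S.c ^ 2))) ≤
      S.η t ^ 2 * (N * d * S.p' / (4 * S.c ^ 2 * S.η (J - 1) ^ 2)) := by
    have hη0 := H.η_pos (J - 1)
    have hc := H.c_pos
    have h1 : 1 ≤ S.η t / S.η (J - 1) := (one_le_div hη0).2 (H.η_anti (by omega))
    have h2 : S.η t ^ 2 * (N * d * S.p' / (4 * S.c ^ 2 * S.η (J - 1) ^ 2)) =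
        (d : ℝ) * (N * (S.p' / (4 * S.c ^ 2))) * (S.η t / S.η (J - 1)) ^ 2 := by field_simp
    rw [h2]
    exact le_mul_of_one_le_right (by positivity) (one_le_pow₀ h1)
  simp_rw [EuclideanSpace.real_norm_sq_eq]
  rw [integral_finsetSum _ fun l _ => ((H.memLp_syncNoise ht).eval_piLp l).integrable_sq]
  have htot := Finset.sum_le_sum fun l (_ : l ∈ Finset.univ) => hcoord l
  rw [Finset.sum_add_distrib, Finset.sum_const, Finset.card_univ, Fintype.card_fin,
    nsmul_eq_mul] at htot
  rw [H.sum_cov] at hsum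
  rw [constC]
  linarith

theorem integral_norm_avgModel_succ_sub_sq_le (H : S.IsRun Z P 𝒟 F L μ J σ G) {t : ℕ} (ht : t < J)
    {s : Model d} (hs : IsMinOn (S.globalObj F) Set.univ s) :
    ∫ ω, ‖S.avgModel Z (t + 1) ω - s‖ ^ 2 ∂P ≤
      (1 - μ * S.η t) * ∫ ω, ‖S.avgModel Z t ω - s‖ ^ 2 ∂P +
        S.η t ^ 2 * (S.constB F L G σ + S.constC G J) := by
  have hstep := H.integral_norm_descentStep_sub_sq_le ht hs
  by_cases h : S.E ∣ t + 1
  · have hn := H.integral_norm_syncNoise_sq_le ht h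
    have hv2 : MemLp (fun ω => S.descentStep Z t ω - s) 2 P :=
      (H.memLp_descentStep ht).sub (memLp_const s)
    have hvm : Measurable[Z.sigmaOn (NoiseLabel.drawn N d t)] fun ω => S.descentStep Z t ω - s :=
      (measurable_descentStep Z H.measurable_sg t).sub_const s
    have hn2 := H.memLp_syncNoise ht
    -- The descent step depends only on the past and the samples of time t, against which the
    -- aggregation noise is centered coordinatewise.
    have hcross : ∫ ω, inner ℝ (S.descentStep Z t ω - s) (S.syncNoise Z t ω) ∂P = 0 := by
      simp only [PiLp.inner_apply, RCLike.inner_apply, conj_trivial]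
      have hint : ∀ l, Integrable (fun ω => S.syncNoise Z t ω l * (S.descentStep Z t ω - s) l) P :=
        fun l => (hn2.eval_piLp l).integrable_mul (hv2.eval_piLp l)
      rw [integral_finsetSum _ fun l _ => hint l]
      refine Finset.sum_eq_zero fun l _ => ?_
      simp_rw [mul_comm (S.syncNoise Z t _ l)]
      exact H.law.integral_mul_aggregationNoise H.c_pos
        (fun j => H.law.integral_contrib H.θ_nonneg (pairProb_pos H.two_le H.α_pos).le j t l)
        (measurable_upload Z H.measurable_sg t l) (H.memLp_upload ht l)
        (measurable_apply_sigma hvm l) (hv2.eval_piLp l)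
    have e : ∀ ω, S.avgModel Z (t + 1) ω - s = (S.descentStep Z t ω - s) - S.syncNoise Z t ω := by
      intro ω
      rw [S.avgModel_succ_sync Z ω H.β_sum H.p'_pos.ne' h]
      abel
    simp_rw [e]
    rw [integral_norm_sub_sq_of_integral_inner_eq_zero hv2 hn2 hcross]
    linarith
  · simp_rw [S.avgModel_succ_local Z _ h]
    nlinarith [mul_nonneg (sq_nonneg (S.η t)) H.constC_nonneg]

end IsRun

end FedScheme

/-- The upper and lower quadratic bounds share their first-order part. Two distinct points are
needed: on a one-point space μ and L are unrelated. -/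
theorem strongConvexity_le_smoothness {V : Type*} [NormedAddCommGroup V] [InnerProductSpace ℝ V]
    [CompleteSpace V] {f : V → ℝ} {L μ : ℝ} (hd : Differentiable ℝ f)
    (hsm : ∀ v w : V, f v ≤ f w + inner ℝ (gradient f w) (v - w) + L / 2 * ‖v - w‖ ^ 2)
    (hsc : StrongConvexOn Set.univ μ f) {v w : V} (hvw : v ≠ w) : μ ≤ L := by
  have h1 := hsm v w
  have h2 := hsc.add_inner_gradient_le hd v w
  have h3 : 0 < ‖v - w‖ ^ 2 := pow_pos (norm_pos_iff.2 (sub_ne_zero.2 hvw)) 2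
  by_contra! h
  nlinarith [mul_pos (sub_pos.2 h) h3]

/-! ### Initial term and solution of the recursion -/

namespace FedScheme.IsRun

variable {N d : ℕ} {Ξ Ω : Type*} [MeasurableSpace Ξ] [MeasurableSpace Ω] {S : FedScheme N d Ξ}
  {Z : FedNoise N d Ξ Ω} {P : Measure Ω} {𝒟 : Fin N → Measure Ξ}
  {F : Fin N → Model d → ℝ} {L μ : ℝ} {J : ℕ} {σ : Fin N → ℝ} {G : ℝ}

theorem avgModel_zero (H : S.IsRun Z P 𝒟 F L μ J σ G) (ω : Ω) : S.avgModel Z 0 ω = S.w₀ := by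
  rw [S.avgModel_eq_of_dvd Z ω H.β_sum (dvd_zero _) ⟨0, by have := H.two_le; omega⟩,
    localModel_zero]

variable [IsProbabilityMeasure P]

/-- The initial distance to the minimizer is controlled by the second moment bound. -/
theorem sq_mul_norm_sub_sq_le (H : S.IsRun Z P 𝒟 F L μ J σ G) (hJ : 0 < J) {s : Model d}
    (hs : IsMinOn (S.globalObj F) Set.univ s) : μ ^ 2 * ‖S.w₀ - s‖ ^ 2 ≤ G ^ 2 := by
  have hd := fun i => (H.smooth i).1
  have h1 := (globalObj_strongConvexOn H.β_nonneg H.β_sum H.convex).mul_norm_sub_le_norm_gradient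
    (globalObj_smooth H.β_nonneg H.β_sum H.smooth).1 (gradient_globalObj_eq_zero hs) S.w₀
  rw [(hasGradientAt_globalObj hd S.w₀).gradient] at h1
  have h2 := pow_le_pow_left₀ (mul_nonneg H.μ_pos.le (norm_nonneg _)) h1 2
  rw [mul_pow] at h2
  refine h2.trans ((norm_sum_smul_sq_le H.β_nonneg H.β_sum _).trans ?_)
  calc ∑ i, S.β i * ‖gradient (F i) S.w₀‖ ^ 2 ≤ ∑ i, S.β i * G ^ 2 :=
        Finset.sum_le_sum fun i _ => mul_le_mul_of_nonneg_left
          (H.norm_gradient_sq_le_moment hJ i) (H.β_nonneg i)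
    _ = G ^ 2 := by rw [← Finset.sum_mul, H.β_sum, one_mul]

/-- The initial term of the recursion is dominated by the claimed rate. -/
theorem mul_norm_sub_sq_le (H : S.IsRun Z P 𝒟 F L μ J σ G) (hJ : 0 < J) {s : Model d}
    (hs : IsMinOn (S.globalObj F) Set.univ s) :
    max (8 * (L / μ)) (S.E : ℝ) * ‖S.w₀ - s‖ ^ 2 ≤
      4 * (S.constB F L G σ + S.constC G J) / μ ^ 2 + 8 * (L / μ) * ‖S.w₀ - s‖ ^ 2 := by
  have hμ := H.μ_pos
  have hL := H.L_pos
  have hB := H.le_constB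
  have hC := H.constC_nonneg
  have hK : 0 ≤ 4 * (S.constB F L G σ + S.constC G J) / μ ^ 2 := by
    have : 0 ≤ S.constB F L G σ := le_trans (by positivity) hB
    positivity
  rcases eq_or_ne S.w₀ s with h | h
  · simpa [h] using hK
  rcases le_total (S.E : ℝ) (8 * (L / μ)) with hE | hE
  · rw [max_eq_left hE]
    linarith
  · rw [max_eq_right hE]
    have hf := globalObj_smooth H.β_nonneg H.β_sum H.smooth
    have hμL : μ ≤ L := strongConvexity_le_smoothness hf.1 hf.2
      (globalObj_strongConvexOn H.β_nonneg H.β_sum H.convex) h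
    have h8 : (8 : ℝ) ≤ S.E := by
      have := (one_le_div hμ).2 hμL
      linarith
    have hG := H.sq_mul_norm_sub_sq_le hJ hs
    have h1 : (S.E : ℝ) * ‖S.w₀ - s‖ ^ 2 ≤
        4 * (S.constB F L G σ + S.constC G J) / μ ^ 2 := by
      rw [le_div_iff₀ (by positivity)]
      have h2 : (S.E : ℝ) * (μ ^ 2 * ‖S.w₀ - s‖ ^ 2) ≤ S.E * G ^ 2 :=
        mul_le_mul_of_nonneg_left hG (by positivity)
      -- The 32 is 4 times the 8 in B; E ≤ 32(E - 1)² holds since E ≥ 8L/μ ≥ 8.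
      have h3 : (S.E : ℝ) * G ^ 2 ≤ 32 * ((S.E : ℝ) - 1) ^ 2 * G ^ 2 :=
        mul_le_mul_of_nonneg_right (by nlinarith) (sq_nonneg G)
      linarith
    have h4 : 0 ≤ 8 * (L / μ) * ‖S.w₀ - s‖ ^ 2 := by positivity
    linarith

theorem integral_norm_avgModel_sub_sq_le (H : S.IsRun Z P 𝒟 F L μ J σ G) (hJ : 0 < J) {s : Model d}
    (hs : IsMinOn (S.globalObj F) Set.univ s) {ν : ℝ} (hν : ν = max (8 * (L / μ)) (S.E : ℝ))
    (hη : ∀ t : ℕ, S.η t = 2 / (μ * (ν + t))) :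
    ∫ ω, ‖S.avgModel Z J ω - s‖ ^ 2 ∂P ≤
      (4 * (S.constB F L G σ + S.constC G J) / μ ^ 2 + 8 * (L / μ) * ‖S.w₀ - s‖ ^ 2) /
        (ν + J) := by
  have hμ := H.μ_pos
  have hL := H.L_pos
  have h8 : 8 * (L / μ) ≤ ν := hν ▸ le_max_left _ _
  have hν0 : 0 < ν := lt_of_lt_of_le (by positivity) h8
  have hv : 0 ≤ 4 * (S.constB F L G σ + S.constC G J) / μ ^ 2 + 8 * (L / μ) * ‖S.w₀ - s‖ ^ 2 :=
    le_trans (by positivity) (H.mul_norm_sub_sq_le hJ hs)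
  -- In dimension 0 all distances vanish. Otherwise distinct points exist, so μ ≤ L and ν ≥ 8, which
  -- provides 2 ≤ ν for the recursion.
  rcases subsingleton_or_nontrivial (Model d) with hd | hd
  · have h0 : ∀ ω, S.avgModel Z J ω - s = 0 := fun ω => Subsingleton.elim _ _
    simp only [h0, norm_zero]
    simp only [ne_eq, OfNat.ofNat_ne_zero, not_false_eq_true, zero_pow, integral_zero]
    positivity
  · obtain ⟨x, y, hxy⟩ := exists_pair_ne (Model d)
    have hf := globalObj_smooth H.β_nonneg H.β_sum H.smooth
    have hμL : μ ≤ L := strongConvexity_le_smoothness hf.1 hf.2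
      (globalObj_strongConvexOn H.β_nonneg H.β_sum H.convex) hxy
    have hν2 : 2 ≤ ν := by
      have := (one_le_div hμ).2 hμL
      linarith
    refine le_div_of_contraction_recursion (Δ := fun t => ∫ ω, ‖S.avgModel Z t ω - s‖ ^ 2 ∂P)
      (K := S.constB F L G σ + S.constC G J) hμ hν2 ?_ hv
      (le_add_of_nonneg_right (by positivity)) (fun t ht => ?_) J le_rfl
    · simp only [H.avgModel_zero, integral_const, probReal_univ, one_smul]
      rw [hν]
      exact H.mul_norm_sub_sq_le hJ hs
    · rw [← hη t]
      exact H.integral_norm_avgModel_succ_sub_sq_le ht hs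

end FedScheme.IsRun

theorem mainTheorem1 {N d : ℕ} {Ξ Ω : Type*} [MeasurableSpace Ξ] [MeasurableSpace Ω]
    (P : Measure Ω) [IsProbabilityMeasure P]
    (S : FedScheme N d Ξ) (Z : FedNoise N d Ξ Ω)
    -- the parameters of the scheme
    (hβ : ∀ i, 0 ≤ S.β i) (hβ_sum : ∑ i, S.β i = 1)
    (hθ₀ : 0 ≤ S.θ) (hθ₁ : S.θ < 1)
    (hN : 2 ≤ N) (hα₀ : 0 < S.α) (hα₁ : S.α ≤ (N : ℝ) - 1)
    (hc : 0 < S.c) (hE : 1 ≤ S.E)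
    -- the randomness
    (𝒟 : Fin N → Measure Ξ) (hZ : Z.HasJointLaw P 𝒟 S.θ S.pairProb)
    -- the local objectives
    (F : Fin N → Model d → ℝ) (L μ : ℝ) (hμ : 0 < μ) (hL : 0 < L)
    (hsmooth : ∀ i, LSmooth L (F i))
    (hconvex : ∀ i, StrongConvexOn Set.univ μ (F i))
    -- unbiased stochastic gradients
    (hsg : ∀ i, Measurable (Function.uncurry (S.sg i)))
    (hsg_unbiased : ∀ i w, Integrable (S.sg i w) (𝒟 i) ∧
      ∫ x, S.sg i w x ∂(𝒟 i) = gradient (F i) w)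
    -- the final round
    (J : ℕ) (hJ₀ : 0 < J) (hJ : S.E ∣ J)
    -- bounded variance and bounded second moment along the iterates
    (σ : Fin N → ℝ) (G : ℝ)
    (hσ : ∀ i, ∀ t < J,
      Integrable (fun ω => ‖S.stochGrad Z i t ω - gradient (F i) (S.localModel Z ω t i)‖ ^ 2) P ∧
      ∫ ω, ‖S.stochGrad Z i t ω - gradient (F i) (S.localModel Z ω t i)‖ ^ 2 ∂P ≤ σ i ^ 2)
    (hG : ∀ i, ∀ t < J,
      Integrable (fun ω => ‖S.stochGrad Z i t ω‖ ^ 2) P ∧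
      ∫ ω, ‖S.stochGrad Z i t ω‖ ^ 2 ∂P ≤ G ^ 2)
    -- the learning rates
    (ν : ℝ) (hν : ν = max (8 * (L / μ)) (S.E : ℝ))
    (hη : ∀ t : ℕ, S.η t = 2 / (μ * (ν + t)))
    -- the minimizer of the global objective
    (wstar : Model d) (hwstar : IsMinOn (S.globalObj F) Set.univ wstar) :
    Integrable (fun ω => S.globalObj F (S.avgModel Z J ω)) P ∧
    ∫ ω, S.globalObj F (S.avgModel Z J ω) ∂P - (⨅ w, S.globalObj F w) ≤
      2 * (L / μ) / (ν + J) *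
        ((S.constB F L G σ + S.constC G J) / μ + 2 * L * ‖S.w₀ - wstar‖ ^ 2) := by
  have hLμ : 0 < L / μ := div_pos hL hμ
  have hν8 : 8 * (L / μ) ≤ ν := hν ▸ le_max_left _ _
  have hνE : (S.E : ℝ) ≤ ν := hν ▸ le_max_right _ _
  have hν0 : 0 < ν := lt_of_lt_of_le (by positivity) hν8
  have hpos : ∀ t : ℕ, 0 < ν + t := fun t => by positivity
  have H : S.IsRun Z P 𝒟 F L μ J σ G :=
    { β_nonneg := hβ
      β_sum := hβ_sum
      θ_nonneg := hθ₀
      θ_lt_one := hθ₁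
      two_le := hN
      α_pos := hα₀
      α_le := hα₁
      c_pos := hc
      E_pos := hE
      law := hZ
      μ_pos := hμ
      L_pos := hL
      smooth := hsmooth
      convex := hconvex
      measurable_sg := hsg
      unbiased := hsg_unbiased
      variance := hσ
      moment := hG
      η_pos := fun t => by rw [hη]; exact div_pos two_pos (mul_pos hμ (hpos t))
      η_anti := fun s t hst => by
        rw [hη, hη]
        have : (s : ℝ) ≤ t := by exact_mod_cast hst
        exact div_le_div_of_nonneg_left zero_le_two (mul_pos hμ (hpos s))
          (mul_le_mul_of_nonneg_left (by linarith) hμ.le)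
      -- Equivalent to ν + t + E ≤ 2(ν + t), which follows from ν ≥ E.
      η_le := fun t => by
        have ht : (0 : ℝ) ≤ t := Nat.cast_nonneg t
        rw [hη, hη, ← mul_div_assoc, div_le_div_iff₀ (mul_pos hμ (hpos t)) (mul_pos hμ (hpos _))]
        push_cast
        nlinarith
      η_small := fun t => by
        have h1 : 8 * L ≤ ν * μ := by
          have := mul_le_mul_of_nonneg_right hν8 hμ.le
          rwa [mul_assoc, div_mul_cancel₀ _ hμ.ne'] at this
        rw [hη, ← mul_div_assoc, div_le_one (mul_pos hμ (hpos t))]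
        nlinarith [mul_nonneg hμ.le (Nat.cast_nonneg (α := ℝ) t)] }
  have hsmF := FedScheme.globalObj_smooth hβ hβ_sum hsmooth
  have hmin : ∀ w, S.globalObj F wstar ≤ S.globalObj F w := fun w => hwstar (Set.mem_univ w)
  have hup : ∀ w, S.globalObj F w ≤ S.globalObj F wstar + L / 2 * ‖w - wstar‖ ^ 2 := by
    intro w
    have h := hsmF.2 w wstar
    rwa [FedScheme.gradient_globalObj_eq_zero hwstar, inner_zero_left, add_zero] at h
  have hsq : Integrable (fun ω => ‖S.avgModel Z J ω - wstar‖ ^ 2) P :=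
    ((H.memLp_avgModel le_rfl).sub (memLp_const wstar)).integrable_norm_sq
  have hbound : Integrable
      (fun ω => S.globalObj F wstar + L / 2 * ‖S.avgModel Z J ω - wstar‖ ^ 2) P :=
    (integrable_const _).add (hsq.const_mul _)
  have hmeas : Measurable fun ω => S.globalObj F (S.avgModel Z J ω) :=
    hsmF.1.continuous.measurable.comp
      (hZ.measurable_of_sigmaOn (FedScheme.measurable_avgModel Z hsg J))
  -- F along the run lies between its minimum and a quadratic in the average model, which is
  -- square-integrable.
  have hint : Integrable (fun ω => S.globalObj F (S.avgModel Z J ω)) P :=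
    integrable_of_le_of_le hmeas.aestronglyMeasurable
      (Filter.Eventually.of_forall fun _ => hmin _) (Filter.Eventually.of_forall fun _ => hup _)
      (integrable_const _) hbound
  refine ⟨hint, ?_⟩
  have h1 := integral_mono hint hbound fun ω => hup _
  rw [integral_add (integrable_const _) (hsq.const_mul _), integral_const_mul, integral_const,
    probReal_univ, one_smul] at h1
  have h2 := mul_le_mul_of_nonneg_left (H.integral_norm_avgModel_sub_sq_le hJ₀ hwstar hν hη)
    (by positivity : 0 ≤ L / 2)
  have hJpos := hpos J
  have h3 : L / 2 * ((4 * (S.constB F L G σ + S.constC G J) / μ ^ 2 +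
      8 * (L / μ) * ‖S.w₀ - wstar‖ ^ 2) / (ν + J)) = 2 * (L / μ) / (ν + J) *
      ((S.constB F L G σ + S.constC G J) / μ + 2 * L * ‖S.w₀ - wstar‖ ^ 2) := by
    field_simp
    ring
  rw [FedScheme.iInf_eq_of_isMinOn_univ hwstar]
  linarith
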